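/- For $\beta>1$ let $\mathbb{Z}_\beta=\mathbb{Z}_\beta^+\cup(-\mathbb{Z}_\beta^+)$, where $\mathbb{Z}_\beta^+$ is the set of real numbers $x\ge 0$ whose R\'enyi $\beta$-expansion has no fractional part, and let $\mathbb{Z}_{-\beta}$ be the set of real numbers whose Ito--Sadahiro $(-\beta)$-expansion has no fractional part. Here, for a base $\alpha$ and an interval $[l,l+1)$, the digits of $y\in[l,l+1)$ are $y_i=\lfloor \alpha T^{i-1}(y)-l\rfloor$ ($i\ge 1$) with $T(y)=\alpha y-\lfloor\alpha y-l\rfloor$, so that $y=\sum_{i\ge1}y_i\alpha^{-i}$; the expansion of a real $x$ is obtained from the digits of $y=x/\alpha^k$ by multiplying by $\alpha^k$, for any $k\in\mathbb{Z}$ such that $y$ is an admitted starting point. In the R\'enyi case $\alpha=\beta$, $l=0$, and $y\in[0,1)$ is required; in the Ito--Sadahiro case $\alpha=-\beta$, $l=-\frac{\beta}{\beta+1}$, and $y\in(l,l+1)$ is required. The language $\mathcal{L}(w)$ of a one-sided or bidirectional infinite word $w$ is the set of its finite factors. Let $\pi,\tilde\pi$ be the morphisms on $\{0,1\}^*$ given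 by $\pi:0\mapsto 0,\ 1\mapsto 10$ and $\tilde\pi:0\mapsto 0,\ 1\mapsto 01$, extended to infinite words letter by letter (keeping the position of the origin for pointed bidirectional words). Let $m,n$ be integers and let $\beta>1$ satisfy one of the following: (A) $\beta$ is the root of $x^2-mx-n$ with $m>n\ge 1$; put $\Delta_0^+=\Delta_0^-=1$, $\Delta_1^+=\frac n\beta$, $\Delta_1^-=1+\frac n\beta$; (B) $\beta$ is the root of $x^2-mx+n$ with $m-2\ge n\ge 1$; put $\Delta_0^+=\Delta_0^-=1$, $\Delta_1^+=1-\frac n\beta$, $\Delta_1^-=2-\frac n\beta$. Then each of $\mathbb{Z}_\beta$ and $\mathbb{Z}_{-\beta}$ can be enumerated increasingly as $\{t_j\mid j\in\mathbb{Z}\}$ with $t_0=0$, and the distances between consecutive elements of $\mathbb{Z}_\beta$ (respectively $\mathbb{Z}_{-\beta}$) lie in $\{\Delta_0^+,\Delta_1^+\}$ (respectively $\{\Delta_0^-,\Delta_1^-\}$). Let $u_\beta=u_0u_1u_2\cdots\in\{0,1\}^{\mathbb{N}}$ be defined by $u_j=X$ if $t_{j+1}-t_j=\Delta_X^+$ in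 $\mathbb{Z}_\beta$ ($j\ge 0$), let $u_{-\beta}=\cdots u_{-2}u_{-1}|u_0u_1\cdots\in\{0,1\}^{\mathbb{Z}}$ be defined by $u_j=X$ if $t_{j+1}-t_j=\Delta_X^-$ in $\mathbb{Z}_{-\beta}$ ($j\in\mathbb{Z}$), and let $u_{-\beta}^+=u_0u_1u_2\cdots$ be the part of $u_{-\beta}$ to the right of the origin. In case (A), $\mathcal{L}(u_\beta)=\mathcal{L}(\tilde\pi(u_{-\beta}))$, and moreover $u_\beta=\pi(u_{-\beta}^+)$ if $n=1$. In case (B), $\mathcal{L}(u_\beta)=\mathcal{L}(\pi(u_{-\beta}))$. -/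

import Mathlib

/-! Number systems with a positive or negative real base, and words coding their integers. -/

namespace BetaInt

noncomputable section

/-- The transformation `T(x) = α x - ⌊α x - l⌋` of the interval `[l, l+1)`. -/
def T (α l x : ℝ) : ℝ := α * x - (⌊α * x - l⌋ : ℝ)

/-- The digits of `d(x)` for `x ∈ [l, l+1)`: `digit α l x i` is the coefficient of `α^{-(i+1)}`,
that is, `⌊α T^i(x) - l⌋`. -/
def digit (α l x : ℝ) (i : ℕ) : ℤ := ⌊α * ((T α l)^[i] x) - l⌋

/-- The expansion of `x` in base `α` has no fractional part: if `x / α^k ∈ J` for some `k`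
(the set `J ⊆ [l, l+1)` holds the admitted starting points), then the digit with index `i` of
`d(x / α^k)` is the coefficient of `α^{k-1-i}` in the expansion of `x`, and it has to vanish
whenever `k - 1 - i < 0`. -/
def HasIntegerExpansion (α l : ℝ) (J : Set ℝ) (x : ℝ) : Prop :=
  ∃ k : ℤ, x / α ^ k ∈ J ∧ ∀ i : ℕ, k ≤ (i : ℤ) → digit α l (x / α ^ k) i = 0

/-- Non-negative `β`-integers (Rényi expansions, `I = [0,1)`). -/
def posIntegers (β : ℝ) : Set ℝ :=
  {x | 0 ≤ x ∧ HasIntegerExpansion β 0 (Set.Ico 0 1) x}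

/-- The set `ℤ_β` of `β`-integers. -/
def betaIntegers (β : ℝ) : Set ℝ :=
  {x | x ∈ posIntegers β ∨ -x ∈ posIntegers β}

/-- The left end-point `l = -β/(β+1)` of the Ito–Sadahiro interval `[l, l+1)`. -/
def negLeft (β : ℝ) : ℝ := -β / (β + 1)

/-- The set `ℤ_{-β}` of `(-β)`-integers (Ito–Sadahiro expansions, computed from a point of the
open interval `(l, l+1)`). -/
def negBetaIntegers (β : ℝ) : Set ℝ :=
  {x | HasIntegerExpansion (-β) (negLeft β) (Set.Ioo (negLeft β) (negLeft β + 1)) x}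

/-- `t` is the increasing enumeration `⋯ < t_{-1} < t_0 = 0 < t_1 < ⋯` of `S`. -/
def Enumerates (S : Set ℝ) (t : ℤ → ℝ) : Prop :=
  StrictMono t ∧ Set.range t = S ∧ t 0 = 0

/-- The one-sided word `u = u_0 u_1 u_2 ⋯` codes the distances between consecutive elements of the
non-negative part of `S`: `t_{j+1} - t_j = Δ_X` where `X = u_j`. -/
def CodesRight (S : Set ℝ) (Δ : Fin 2 → ℝ) (u : ℕ → Fin 2) : Prop :=
  ∃ t : ℤ → ℝ, Enumerates S t ∧ ∀ j : ℕ, t ((j : ℤ) + 1) - t (j : ℤ) = Δ (u j)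

/-- The pointed bidirectional word `⋯ u_{-2} u_{-1} | u_0 u_1 ⋯` codes the distances between
consecutive elements of `S`. -/
def Codes (S : Set ℝ) (Δ : Fin 2 → ℝ) (u : ℤ → Fin 2) : Prop :=
  ∃ t : ℤ → ℝ, Enumerates S t ∧ ∀ j : ℤ, t (j + 1) - t j = Δ (u j)

end

/-- The suffix `u_0 u_1 u_2 ⋯` of a pointed bidirectional word. -/
def rightPart {A : Type*} (u : ℤ → A) : ℕ → A := fun j => u (j : ℤ)

/-- The language (set of all finite factors) of a one-sided infinite word. -/
def language {A : Type*} (u : ℕ → A) : Set (List A) :=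
  {w | ∃ i : ℕ, ∀ (k : ℕ) (hk : k < w.length), w[k] = u (i + k)}

/-- The language (set of all finite factors) of a bidirectional infinite word. -/
def languageZ {A : Type*} (u : ℤ → A) : Set (List A) :=
  {w | ∃ i : ℤ, ∀ (k : ℕ) (hk : k < w.length), w[k] = u (i + (k : ℤ))}

/-- The finite word `σ(u_0) σ(u_1) ⋯ σ(u_{N-1})`. -/
def imagePrefix {A B : Type*} (σ : A → List B) (u : ℕ → A) (N : ℕ) : List B :=
  (List.range N).flatMap fun j => σ (u j)

/-- For a non-erasing morphism the first `N` letters have an image of length at least `N`. -/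
theorem le_length_imagePrefix {A B : Type*} (σ : A → List B) (hσ : ∀ a, σ a ≠ []) (u : ℕ → A)
    (N : ℕ) : N ≤ (imagePrefix σ u N).length := by
  induction N with
  | zero => exact Nat.zero_le _
  | succ N ih =>
    have h : 0 < (σ (u N)).length := List.length_pos_iff.mpr (hσ _)
    simp only [imagePrefix, List.range_succ, List.flatMap_append, List.length_append,
      List.flatMap_cons, List.flatMap_nil, List.append_nil] at ih ⊢
    omega

/-- The image `σ(u_0) σ(u_1) σ(u_2) ⋯` of a one-sided infinite word under the non-erasing morphism
with letter images `σ`. -/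
def image {A B : Type*} (σ : A → List B) (hσ : ∀ a, σ a ≠ []) (u : ℕ → A) (i : ℕ) : B :=
  (imagePrefix σ u (i + 1))[i]'(le_length_imagePrefix σ hσ u (i + 1))

/-- The image `⋯ σ(u_{-2}) σ(u_{-1}) | σ(u_0) σ(u_1) ⋯` of a pointed bidirectional word under the
non-erasing morphism with letter images `σ`. The left half is read from the delimiter leftwards. -/
def imageZ {A B : Type*} (σ : A → List B) (hσ : ∀ a, σ a ≠ []) (u : ℤ → A) : ℤ → B
  | Int.ofNat i => image σ hσ (fun j => u (j : ℤ)) i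
  | Int.negSucc i =>
      image (fun a => (σ a).reverse) (fun a h => hσ a (List.reverse_eq_nil_iff.mp h))
        (fun j => u (Int.negSucc j)) i

/-- The morphism `π : 0 ↦ 0, 1 ↦ 10`. -/
def mor : Fin 2 → List (Fin 2) := ![[0], [1, 0]]

/-- The morphism `π̃ : 0 ↦ 0, 1 ↦ 01`. -/
def morTilde : Fin 2 → List (Fin 2) := ![[0], [0, 1]]

theorem mor_ne_nil : ∀ a, mor a ≠ [] := by decide

theorem morTilde_ne_nil : ∀ a, morTilde a ≠ [] := by decide

end BetaInt

/-! Write β = M + δ with M an integer and 0 < δ < 1. In case (A), M = m and βδ = n; in case (B), M =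
m - 1 = n + ν and βδ = ν + δ. The gaps are 1, δ for ℤ_β and 1, 1 + δ for ℤ_{-β}. Applying π̃ cuts
every long gap after length 1, so both sides become words with letters of lengths 1 and δ; on the
negative side the elements of ℤ_{-β} are the left ends of the letters 0, and a letter 1 is filler.

Splitting by the leading digit gives recursions for finite words. In base β, W_k codes the integers
of [0, β^k) and V_k those of [0, δβ^k): W_{k+1} = W_k^M V_k, while V_{k+1} is W_k^n in (A) and W_k^ν
V_k in (B) (`PosCoding`). In base -β, a_k and c_k code the points x with x/(-β)^k in [l, l+1) and in
[l, l+δ) (`NegCoding`); (A) also needs the words e_k of [l+δ, l+1) (`NegRest`). No other end-points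
arise, because T sends l to l+δ, and l+δ to itself in (A) and to l in (B). This orbit avoids 0, so
end-points are never coded and the reversal of half-open intervals by -β does no harm. The reversal
makes a_{k+1} equal to a_k^M c_k or c_k a_k^M according to the parity of k.

So the two recursions differ only in the order of factors, and one word z conjugates both pairs at
once: Wz = za, Vz = zc in (A), and zW = az, zV = cz in (B) (`fixedLevel_conj`, `returnLevel_conj`).
Conjugate words are factors of each other's squares (`infix_of_conj`), and M ≥ 2 puts these squares
into later levels; hence both families have the same factors (`language_eq_of_recursion`). These
factors form the two languages by `PosTiling.mem_language_iff` and `NegTiling.mem_languageZ_iff`. In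
(B) the morphism π replaces π̃ at no cost, since π̃(w)0 = 0π(w) (`languageZ_mor`).

For n = 1 the word y that follows the letter at the origin in a_k is also a prefix of W_k. With
π̃(w)0 = 0π(w) this identifies u_β letter by letter (`NegTiling.eq_image_rightPart`). -/

namespace BetaInt

/-! ### Powers, lengths and letter positions of finite words -/

section Words

variable {A B : Type*}

/-- The concatenation of `N` copies of `w`. -/
def lpow (w : List A) (N : ℕ) : List A := (List.replicate N w).flatten

@[simp] theorem lpow_zero (w : List A) : lpow w 0 = [] := rfl

theorem lpow_succ (w : List A) (N : ℕ) : lpow w (N + 1) = w ++ lpow w N := by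
  simp [lpow, List.replicate_succ]

theorem lpow_add (w : List A) (N K : ℕ) : lpow w (N + K) = lpow w N ++ lpow w K := by
  rw [lpow, lpow, lpow, ← List.replicate_append_replicate, List.flatten_append]

theorem lpow_succ' (w : List A) (N : ℕ) : lpow w (N + 1) = lpow w N ++ w := by
  rw [lpow_add, lpow_succ, lpow_zero, List.append_nil]

theorem lpow_append_comm (w : List A) (N K : ℕ) :
    lpow w N ++ lpow w K = lpow w K ++ lpow w N := by
  rw [← lpow_add, ← lpow_add, add_comm]

theorem lpow_conj {w z a : List A} (h : w ++ z = z ++ a) (N : ℕ) :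
    lpow w N ++ z = z ++ lpow a N := by
  induction N with
  | zero => simp
  | succ N ih => rw [lpow_succ, lpow_succ, List.append_assoc, ih, ← List.append_assoc, h,
      List.append_assoc]

theorem prefix_lpow (w : List A) {N K : ℕ} (h : N ≤ K) : lpow w N <+: lpow w K := by
  obtain ⟨d, rfl⟩ := Nat.exists_eq_add_of_le h
  rw [lpow_add]
  exact List.prefix_append _ _

/-- If `w z = z a` then `a` is a rotation of `w`. -/
theorem exists_rotation {w a : List A} : ∀ {z : List A}, w ++ z = z ++ a →
    ∃ s t, w = s ++ t ∧ a = t ++ s := by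
  intro z
  induction hn : z.length using Nat.strong_induction_on generalizing z with
  | _ N ih =>
    intro h
    rcases List.append_eq_append_iff.mp h with ⟨t, h1, h2⟩ | ⟨t, h1, h2⟩
    · by_cases hw : w = []
      · subst hw
        have : a = [] := by
          have := congrArg List.length h
          simp only [List.length_append, List.nil_append] at this
          exact List.length_eq_zero_iff.mp (by omega)
        exact ⟨[], [], by simp, by simp [this]⟩
      · have hlen : t.length < N := by
          have h3 := congrArg List.length h1
          have := List.length_pos_iff.mpr hw
          simp only [List.length_append] at h3
          omega
        exact ih _ hlen rfl (h1.symm.trans h2)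
    · exact ⟨z, t, h1, h2⟩

/-- With w = st and a = ts, the word ts is the middle of stst, and conversely. -/
theorem infix_of_conj {w a z : List A} (h : w ++ z = z ++ a) :
    a <:+: w ++ w ∧ w <:+: a ++ a := by
  obtain ⟨s, t, rfl, rfl⟩ := exists_rotation h
  exact ⟨⟨s, t, by simp⟩, ⟨t, s, by simp⟩⟩

/-- The length of a word whose letters `a` have the lengths `Δ a`. -/
noncomputable def wlen (Δ : A → ℝ) (w : List A) : ℝ := (w.map Δ).sum

@[simp] theorem wlen_nil (Δ : A → ℝ) : wlen Δ [] = 0 := by simp [wlen]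

@[simp] theorem wlen_cons (Δ : A → ℝ) (a : A) (w : List A) :
    wlen Δ (a :: w) = Δ a + wlen Δ w := by simp [wlen]

@[simp] theorem wlen_append (Δ : A → ℝ) (w w' : List A) :
    wlen Δ (w ++ w') = wlen Δ w + wlen Δ w' := by simp [wlen]

@[simp] theorem wlen_lpow (Δ : A → ℝ) (w : List A) (N : ℕ) :
    wlen Δ (lpow w N) = N * wlen Δ w := by
  induction N with
  | zero => simp
  | succ N ih => rw [lpow_succ, wlen_append, ih]; push_cast; ring

theorem wlen_nonneg {Δ : A → ℝ} (hΔ : ∀ a, 0 < Δ a) (w : List A) : 0 ≤ wlen Δ w := by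
  induction w with
  | nil => simp
  | cons a w ih => rw [wlen_cons]; linarith [hΔ a]

theorem eq_nil_of_wlen {Δ : A → ℝ} (hΔ : ∀ a, 0 < Δ a) {w : List A} (h : wlen Δ w ≤ 0) :
    w = [] := by
  cases w with
  | nil => rfl
  | cons a w =>
    rw [wlen_cons] at h
    linarith [hΔ a, wlen_nonneg hΔ w]

/-- Two factorizations of a word are compared by the lengths of their first parts. -/
theorem exists_append_of_wlen_le {Δ : A → ℝ} (hΔ : ∀ a, 0 < Δ a) {f g f' g' : List A}
    (h : f ++ g = f' ++ g') (hl : wlen Δ f ≤ wlen Δ f') : ∃ h, f' = f ++ h ∧ g = h ++ g' := by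
  rcases List.append_eq_append_iff.mp h with ⟨t, h1, h2⟩ | ⟨t, h1, h2⟩
  · exact ⟨t, h1, h2⟩
  · have : t = [] := by
      apply eq_nil_of_wlen hΔ
      rw [h1, wlen_append] at hl
      linarith
    subst this
    exact ⟨[], by simpa using h1.symm, by simpa using h2.symm⟩

theorem append_inj_of_wlen {Δ : A → ℝ} (hΔ : ∀ a, 0 < Δ a) {f g f' g' : List A}
    (h : f ++ g = f' ++ g') (hl : wlen Δ f = wlen Δ f') : f = f' ∧ g = g' := by
  obtain ⟨t, h1, h2⟩ := exists_append_of_wlen_le hΔ h hl.le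
  have : t = [] := by
    apply eq_nil_of_wlen hΔ
    rw [h1, wlen_append] at hl
    linarith
  subst this
  exact ⟨by simpa using h1.symm, by simpa using h2⟩

/-- If the letters of `w` have the lengths `Δ` and `w` is placed with its left end at `p`, then
an occurrence of the letter `j` in `w` has its left end at `x`. -/
def Occ (Δ : A → ℝ) : ℝ → List A → ℝ → A → Prop
  | _, [], _, _ => False
  | p, b :: w, x, j => (x = p ∧ j = b) ∨ Occ Δ (p + Δ b) w x j

theorem occ_append {Δ : A → ℝ} {p : ℝ} {w w' : List A} {x : ℝ} {j : A} :
    Occ Δ p (w ++ w') x j ↔ Occ Δ p w x j ∨ Occ Δ (p + wlen Δ w) w' x j := by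
  induction w generalizing p with
  | nil => simp [Occ]
  | cons b w ih =>
    simp only [List.cons_append, Occ, wlen_cons]
    rw [ih, or_assoc, add_assoc]

theorem occ_iff {Δ : A → ℝ} {p : ℝ} {w : List A} {x : ℝ} {j : A} :
    Occ Δ p w x j ↔ ∃ f g, w = f ++ j :: g ∧ p + wlen Δ f = x := by
  constructor
  · induction w generalizing p with
    | nil => simp [Occ]
    | cons b w ih =>
      rintro (⟨rfl, rfl⟩ | h)
      · exact ⟨[], w, by simp, by simp⟩
      · obtain ⟨f, g, rfl, h2⟩ := ih h
        exact ⟨b :: f, g, by simp, by simp [← h2, add_assoc]⟩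
  · rintro ⟨f, g, rfl, rfl⟩
    exact occ_append.mpr (Or.inr (Or.inl ⟨rfl, rfl⟩))

theorem occ_sub {Δ : A → ℝ} {p c : ℝ} {w : List A} {x : ℝ} {j : A} :
    Occ Δ p w (x - c) j ↔ Occ Δ (p + c) w x j := by
  simp only [occ_iff]
  refine exists_congr fun f => exists_congr fun g => and_congr_right fun _ => ?_
  constructor <;> intro h <;> linarith

theorem occ_lpow {Δ : A → ℝ} {p : ℝ} {w : List A} {x : ℝ} {j : A} {N : ℕ} :
    Occ Δ p (lpow w N) x j ↔ ∃ d < N, Occ Δ (p + d * wlen Δ w) w x j := by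
  induction N with
  | zero => simp [Occ]
  | succ N ih =>
    rw [lpow_succ', occ_append, ih, wlen_lpow]
    constructor
    · rintro (⟨d, hd, h⟩ | h)
      · exact ⟨d, by omega, h⟩
      · exact ⟨N, by omega, h⟩
    · rintro ⟨d, hd, h⟩
      rcases Nat.lt_succ_iff_lt_or_eq.mp hd with hd | rfl
      · exact Or.inl ⟨d, hd, h⟩
      · exact Or.inr h

/-- Powers of a word placed from left to right, indexed by an interval. -/
theorem occ_lpow_up {Δ : A → ℝ} {p q L : ℝ} {w : List A} {x : ℝ} {j : A} {lo N : ℕ}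
    (hL : wlen Δ w = L) (hq : q = p + lo * L) :
    Occ Δ q (lpow w N) x j ↔ ∃ d : ℕ, lo ≤ d ∧ d < lo + N ∧ Occ Δ p w (x - d * L) j := by
  subst hL hq
  rw [occ_lpow]
  constructor
  · rintro ⟨d, hd, h⟩
    refine ⟨lo + d, by omega, by omega, occ_sub.mpr ?_⟩
    convert h using 1
    push_cast; ring
  · rintro ⟨d, h1, h2, h⟩
    obtain ⟨i, rfl⟩ := Nat.exists_eq_add_of_le h1
    refine ⟨i, by omega, ?_⟩
    convert occ_sub.mp h using 1
    push_cast; ring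

/-- Powers of a word placed from right to left, indexed by an interval. -/
theorem occ_lpow_down {Δ : A → ℝ} {p q L : ℝ} {w : List A} {x : ℝ} {j : A} {lo N : ℕ}
    (hL : wlen Δ w = L) (hq : q = p - (lo + N - 1) * L) :
    Occ Δ q (lpow w N) x j ↔ ∃ d : ℕ, lo ≤ d ∧ d < lo + N ∧ Occ Δ p w (x - d * (-L)) j := by
  subst hL hq
  rw [occ_lpow]
  constructor
  · rintro ⟨d, hd, h⟩
    -- The copy number d from the left is number e = N - 1 - d from the right, and indices grow
    -- leftwards.
    obtain ⟨e, rfl⟩ := Nat.exists_eq_add_of_lt hd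
    refine ⟨lo + e, by omega, by omega, occ_sub.mpr ?_⟩
    convert h using 1
    push_cast; ring
  · rintro ⟨d, h1, h2, h⟩
    obtain ⟨i, rfl⟩ := Nat.exists_eq_add_of_le h1
    have h3 : i < N := by omega
    obtain ⟨e, rfl⟩ := Nat.exists_eq_add_of_lt h3
    refine ⟨e, by omega, ?_⟩
    convert occ_sub.mp h using 1
    push_cast; ring

/-! ### Windows and languages -/

/-- The factor `f_i f_{i+1} ⋯ f_{i+N-1}`. -/
def window (f : ℤ → B) (i : ℤ) (N : ℕ) : List B := (List.range N).map fun k : ℕ => f (i + (k : ℤ))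

@[simp] theorem window_zero (f : ℤ → B) (i : ℤ) : window f i 0 = [] := rfl

@[simp] theorem length_window (f : ℤ → B) (i : ℤ) (N : ℕ) : (window f i N).length = N := by
  simp [window]

theorem window_add (f : ℤ → B) (i : ℤ) (N K : ℕ) :
    window f i (N + K) = window f i N ++ window f (i + N) K := by
  simp [window, List.range_add, add_assoc]

theorem window_succ (f : ℤ → B) (i : ℤ) (N : ℕ) :
    window f i (N + 1) = window f i N ++ [f (i + N)] := by
  simp [window, List.range_succ]

theorem window_infix (f : ℤ → B) {i i' : ℤ} {N N' : ℕ} (h : i' ≤ i) (h' : i + N ≤ i' + N') :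
    window f i N <:+: window f i' N' := by
  obtain ⟨d, hd⟩ := Int.le.dest h
  obtain ⟨e, he⟩ := Int.le.dest h'
  have : N' = d + N + e := by omega
  subst this
  rw [window_add, window_add, hd]
  exact ⟨_, _, rfl⟩

theorem mem_languageZ {f : ℤ → B} {w : List B} :
    w ∈ languageZ f ↔ ∃ i, w = window f i w.length := by
  refine exists_congr fun i => ?_
  constructor
  · intro h
    apply List.ext_getElem (by simp)
    intro k h1 h2
    simpa [window] using h k h1
  · intro h k hk
    have : w[k]? = (window f i w.length)[k]? := by rw [← h]
    simpa [window, hk] using this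

theorem mem_languageZ_of_infix {f : ℤ → B} {w : List B} {i : ℤ} {N : ℕ}
    (h : w <:+: window f i N) : w ∈ languageZ f := by
  obtain ⟨s, t, h⟩ := h
  rw [mem_languageZ]
  refine ⟨i + s.length, ?_⟩
  have hN : N = s.length + w.length + t.length := by
    have := congrArg List.length h
    simp at this
    omega
  subst hN
  rw [window_add, window_add] at h
  have h1 := (List.append_inj h (by simp)).1
  exact (List.append_inj h1 (by simp)).2

theorem mem_language {f : ℕ → B} {w : List B} :
    w ∈ language f ↔ ∃ N, w <:+: (List.range N).map f := by
  constructor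
  · rintro ⟨i, h⟩
    refine ⟨i + w.length, (List.range i).map f, [], ?_⟩
    simp only [List.append_nil, List.range_add, List.map_append, List.append_cancel_left_eq]
    apply List.ext_getElem (by simp)
    intro k h1 h2
    simpa using h k h1
  · rintro ⟨N, s, t, h⟩
    refine ⟨s.length, fun k hk => ?_⟩
    have : (s ++ w ++ t)[s.length + k]? = ((List.range N).map f)[s.length + k]? := by rw [h]
    have hN : s.length + k < N := by
      have := congrArg List.length h
      simp at this
      omega
    rw [List.append_assoc, List.getElem?_append_right (by omega), Nat.add_sub_cancel_left,
      List.getElem?_append_left hk] at this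
    simpa [hk, hN] using this

/-! ### Images of infinite words under morphisms -/

theorem imagePrefix_succ (σ : A → List B) (u : ℕ → A) (N : ℕ) :
    imagePrefix σ u (N + 1) = imagePrefix σ u N ++ σ (u N) := by
  simp [imagePrefix, List.range_succ]

theorem imagePrefix_prefix (σ : A → List B) (u : ℕ → A) {N K : ℕ} (h : N ≤ K) :
    imagePrefix σ u N <+: imagePrefix σ u K := by
  induction K, h using Nat.le_induction with
  | base => exact List.prefix_rfl
  | succ K _ ih =>
    rw [imagePrefix_succ]
    exact ih.trans (List.prefix_append _ _)

/-- Images of prefixes are nested, so a letter may be read from any of them that is long enough, not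
only from the one used in `image`. -/
theorem image_eq_getElem (σ : A → List B) (hσ : ∀ a, σ a ≠ []) (u : ℕ → A) {N i : ℕ}
    (h : i < (imagePrefix σ u N).length) : image σ hσ u i = (imagePrefix σ u N)[i] := by
  have h1 : i < (imagePrefix σ u (i + 1)).length := le_length_imagePrefix σ hσ u (i + 1)
  change (imagePrefix σ u (i + 1))[i] = _
  rcases le_total (i + 1) N with hN | hN
  · exact (imagePrefix_prefix σ u hN).getElem h1
  · exact ((imagePrefix_prefix σ u hN).getElem h).symm

theorem map_image (σ : A → List B) (hσ : ∀ a, σ a ≠ []) (u : ℕ → A) (N : ℕ) :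
    (List.range (imagePrefix σ u N).length).map (image σ hσ u) = imagePrefix σ u N := by
  apply List.ext_getElem (by simp)
  intro k h1 h2
  simpa using image_eq_getElem σ hσ u h2

theorem imagePrefix_eq_flatMap (σ : A → List B) (u : ℕ → A) (N : ℕ) :
    imagePrefix σ u N = ((List.range N).map u).flatMap σ := by
  simp [imagePrefix, List.flatMap_map]

theorem window_imageZ_right (σ : A → List B) (hσ : ∀ a, σ a ≠ []) (u : ℤ → A) (N : ℕ) :
    window (imageZ σ hσ u) 0 ((window u 0 N).flatMap σ).length = (window u 0 N).flatMap σ := by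
  have h := map_image σ hσ (fun j => u (j : ℤ)) N
  rw [imagePrefix_eq_flatMap] at h
  have h1 : (List.range N).map (fun j : ℕ => u (j : ℤ)) = window u 0 N := by simp [window]
  rw [h1] at h
  conv_rhs => rw [← h]
  rw [window]
  apply List.map_congr_left
  intro k _
  rw [zero_add]
  rfl

theorem window_reverse (f : ℤ → B) (N : ℕ) :
    window f (-N) N = ((List.range N).map fun j => f (Int.negSucc j)).reverse := by
  apply List.ext_getElem (by simp)
  intro k h1 h2
  simp only [length_window] at h1
  simp only [window, List.getElem_map, List.getElem_range, List.getElem_reverse, List.length_map,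
    List.length_range]
  congr 1
  omega

theorem flatMap_reverse_reverse (σ : A → List B) (w : List A) :
    (w.flatMap fun a => (σ a).reverse).reverse = w.reverse.flatMap σ := by
  induction w with
  | nil => rfl
  | cons a w ih => simp [List.flatMap_cons, ih]

theorem window_imageZ_left (σ : A → List B) (hσ : ∀ a, σ a ≠ []) (u : ℤ → A) (N : ℕ) :
    window (imageZ σ hσ u) (-((window u (-N) N).flatMap σ).length)
      ((window u (-N) N).flatMap σ).length = (window u (-N) N).flatMap σ := by
  have h := map_image (fun a => (σ a).reverse)
    (fun a h => hσ a (List.reverse_eq_nil_iff.mp h)) (fun j => u (Int.negSucc j)) N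
  rw [imagePrefix_eq_flatMap] at h
  have h1 : (window u (-N) N).flatMap σ =
      (((List.range N).map fun j => u (Int.negSucc j)).flatMap fun a => (σ a).reverse).reverse := by
    rw [flatMap_reverse_reverse, window_reverse]
  rw [h1, List.length_reverse, window_reverse]
  congr 1

/-- The language of the image of a bidirectional word. -/
theorem mem_languageZ_imageZ (σ : A → List B) (hσ : ∀ a, σ a ≠ []) (u : ℤ → A) (w : List B) :
    w ∈ languageZ (imageZ σ hσ u) ↔ ∃ i N, w <:+: (window u i N).flatMap σ := by
  -- `imageZ` is defined by two halves, so only windows that straddle the origin are images of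
  -- windows in an evident way. They exhaust the line, because the morphism does not erase.
  have key : ∀ N : ℕ, ∃ a b : ℕ, N ≤ a ∧ N ≤ b ∧
      window (imageZ σ hσ u) (-a) (a + b) = (window u (-N) (N + N)).flatMap σ := by
    intro N
    have hl : ∀ w : List A, w.length ≤ (w.flatMap σ).length := by
      intro w
      induction w with
      | nil => simp
      | cons c w ih =>
        have := List.length_pos_iff.mpr (hσ c)
        simp only [List.flatMap_cons, List.length_append, List.length_cons]
        omega
    refine ⟨((window u (-N) N).flatMap σ).length, ((window u 0 N).flatMap σ).length, ?_, ?_, ?_⟩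
    · simpa using hl (window u (-N) N)
    · simpa using hl (window u 0 N)
    · rw [window_add, window_imageZ_left, neg_add_cancel, window_imageZ_right, window_add,
        neg_add_cancel, List.flatMap_append]
  constructor
  · rw [mem_languageZ]
    rintro ⟨i, h⟩
    obtain ⟨a, b, ha, hb, hab⟩ := key (i.natAbs + w.length)
    refine ⟨-(i.natAbs + w.length : ℕ), i.natAbs + w.length + (i.natAbs + w.length), ?_⟩
    rw [← hab, h]
    exact window_infix _ (by omega) (by omega)
  · rintro ⟨i, N, h⟩
    obtain ⟨a, b, ha, hb, hab⟩ := key (i.natAbs + N)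
    have h1 : window u i N <:+: window u (-(i.natAbs + N : ℕ)) (i.natAbs + N + (i.natAbs + N)) :=
      window_infix _ (by omega) (by omega)
    obtain ⟨s, t, h2⟩ := h1
    refine mem_languageZ_of_infix (h.trans ?_) (i := -a) (N := a + b)
    rw [hab, ← h2, List.flatMap_append, List.flatMap_append]
    exact ⟨_, _, rfl⟩

end Words

/-! ### The morphisms `0 ↦ 0, 1 ↦ 10` and `0 ↦ 0, 1 ↦ 01` -/

/-- The letter 0 passes through one block at a time: 01·0 = 0·10. -/
theorem flatMap_morTilde_append (w : List (Fin 2)) :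
    w.flatMap morTilde ++ [0] = 0 :: w.flatMap mor := by
  induction w with
  | nil => rfl
  | cons a w ih =>
    rw [List.flatMap_cons, List.flatMap_cons, List.append_assoc, ih]
    fin_cases a <;> simp [mor, morTilde]

/-- The images of a window under the two morphisms differ by a shift of one letter 0. One more
letter of the bidirectional word supplies it: every block of π̃ begins with 0 and every block of π
ends with 0. -/
theorem languageZ_mor (v : ℤ → Fin 2) :
    languageZ (imageZ mor mor_ne_nil v) = languageZ (imageZ morTilde morTilde_ne_nil v) := by
  ext w
  rw [mem_languageZ_imageZ, mem_languageZ_imageZ]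
  constructor
  · rintro ⟨i, N, h⟩
    refine ⟨i, N + 1, h.trans ?_⟩
    obtain ⟨t, ht⟩ : ∃ t, morTilde (v (i + N)) = 0 :: t := by
      generalize v (i + N) = c
      fin_cases c <;> exact ⟨_, rfl⟩
    rw [window_succ, List.flatMap_append]
    refine ⟨[0], t, ?_⟩
    have h1 : [0] ++ (window v i N).flatMap mor = (window v i N).flatMap morTilde ++ [0] := by
      rw [flatMap_morTilde_append]; rfl
    rw [h1]
    simp [List.flatMap_cons, ht]
  · rintro ⟨i, N, h⟩
    refine ⟨i - 1, 1 + N, h.trans ?_⟩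
    obtain ⟨t, ht⟩ : ∃ t, mor (v (i - 1)) = t ++ [0] := by
      generalize v (i - 1) = c
      fin_cases c
      · exact ⟨[], rfl⟩
      · exact ⟨[1], rfl⟩
    rw [window_add, List.flatMap_append]
    refine ⟨t, [0], ?_⟩
    rw [List.append_assoc, flatMap_morTilde_append]
    simp [window, List.flatMap_cons, ht]

end BetaInt
namespace BetaInt

/-! ### Increasing enumerations of discrete sets -/

section Enumeration

/-- Every element `x` of `S` has the next element `x + Δ j` for some letter `j`. -/
def HasGaps (S : Set ℝ) (Δ : Fin 2 → ℝ) : Prop :=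
  ∀ x ∈ S, ∃ j, x + Δ j ∈ S ∧ ∀ z ∈ S, x < z → x + Δ j ≤ z

theorem exists_pos_lower_bound {Δ : Fin 2 → ℝ} (hΔ : ∀ j, 0 < Δ j) :
    ∃ ε, 0 < ε ∧ ∀ j, ε ≤ Δ j :=
  ⟨min (Δ 0) (Δ 1), lt_min (hΔ 0) (hΔ 1), fun j => by
    fin_cases j
    · exact min_le_left _ _
    · exact min_le_right _ _⟩

/-- A discrete set of non-negative numbers can be enumerated increasingly. -/
theorem exists_nat_enumeration {S : Set ℝ} {ε : ℝ} (hε : 0 < ε) (h0 : 0 ∈ S)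
    (hS : ∀ x ∈ S, 0 ≤ x)
    (hnext : ∀ x ∈ S, ∃ y ∈ S, x + ε ≤ y ∧ ∀ z ∈ S, x < z → y ≤ z) :
    ∃ t : ℕ → ℝ, StrictMono t ∧ Set.range t = S ∧ t 0 = 0 := by
  choose! f hf1 hf2 hf3 using hnext
  let t : ℕ → ℝ := fun n => f^[n] 0
  have ht : ∀ n, t (n + 1) = f (t n) := fun n => Function.iterate_succ_apply' f n 0
  have hmem : ∀ n, t n ∈ S := by
    intro n
    induction n with
    | zero => exact h0
    | succ n ih => rw [ht]; exact hf1 _ ih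
  have hlow : ∀ n : ℕ, n * ε ≤ t n := by
    intro n
    induction n with
    | zero => simp [t]
    | succ n ih =>
      rw [ht]
      push_cast
      linarith [hf2 _ (hmem n)]
  have hmono : StrictMono t := strictMono_nat_of_lt_succ fun n => by
    rw [ht]; linarith [hf2 _ (hmem n)]
  refine ⟨t, hmono, ?_, rfl⟩
  ext x
  constructor
  · rintro ⟨n, rfl⟩
    exact hmem n
  · intro hx
    have hex : ∃ n, x < t n := by
      obtain ⟨n, hn⟩ := exists_nat_gt (x / ε)
      exact ⟨n, ((div_lt_iff₀ hε).mp hn).trans_le (hlow n)⟩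
    classical
    have h1 := Nat.find_spec hex
    cases hn : Nat.find hex with
    | zero =>
      rw [hn] at h1
      exact absurd (hS x hx) (not_le.mpr h1)
    | succ n =>
      rw [hn] at h1
      have h2 : t n ≤ x := not_lt.mp (Nat.find_min hex (by omega))
      rcases h2.lt_or_eq with h2 | h2
      · rw [ht] at h1
        exact absurd (hf3 _ (hmem n) x hx h2) (not_le.mpr h1)
      · exact ⟨n, h2⟩

/-- A discrete set that is unbounded on both sides can be enumerated increasingly by `ℤ`. -/
theorem exists_enumerates {S : Set ℝ} {ε : ℝ} (hε : 0 < ε) (h0 : 0 ∈ S)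
    (hnext : ∀ x ∈ S, 0 ≤ x → ∃ y ∈ S, x + ε ≤ y ∧ ∀ z ∈ S, x < z → y ≤ z)
    (hprev : ∀ x ∈ S, x ≤ 0 → ∃ y ∈ S, y + ε ≤ x ∧ ∀ z ∈ S, z < x → z ≤ y) :
    ∃ t : ℤ → ℝ, Enumerates S t := by
  obtain ⟨p, hp1, hp2, hp3⟩ := exists_nat_enumeration (S := {x | x ∈ S ∧ 0 ≤ x}) hε ⟨h0, le_rfl⟩
    (fun x hx => hx.2) (by
      rintro x ⟨hx, hx0⟩
      obtain ⟨y, hy, hxy, hz⟩ := hnext x hx hx0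
      exact ⟨y, ⟨hy, by linarith⟩, hxy, fun z hz' => hz z hz'.1⟩)
  obtain ⟨q, hq1, hq2, hq3⟩ := exists_nat_enumeration (S := {x | -x ∈ S ∧ 0 ≤ x}) hε
    ⟨by simpa using h0, le_rfl⟩ (fun x hx => hx.2) (by
      rintro x ⟨hx, hx0⟩
      obtain ⟨y, hy, hxy, hz⟩ := hprev (-x) hx (by linarith)
      refine ⟨-y, ⟨by simpa using hy, by linarith⟩, by linarith, fun z hz' hxz => ?_⟩
      linarith [hz (-z) hz'.1 (by linarith)])
  let t : ℤ → ℝ := fun z => match z with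
    | Int.ofNat n => p n
    | Int.negSucc n => -q (n + 1)
  have hp : ∀ n, p n ∈ S ∧ 0 ≤ p n := fun n => by
    have : p n ∈ {x | x ∈ S ∧ 0 ≤ x} := hp2 ▸ Set.mem_range_self n
    exact this
  have hq : ∀ n, -q n ∈ S ∧ 0 ≤ q n := fun n => by
    have : q n ∈ {x | -x ∈ S ∧ 0 ≤ x} := hq2 ▸ Set.mem_range_self n
    exact this
  refine ⟨t, strictMono_int_of_lt_succ fun z => ?_, ?_, hp3⟩
  · cases z with
    | ofNat n => exact hp1 (Nat.lt_succ_self n)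
    | negSucc n =>
      cases n with
      | zero =>
        change -q 1 < p 0
        have := hq1 (Nat.lt_succ_self 0)
        simp only [Nat.succ_eq_add_one, zero_add] at this
        rw [hp3]; rw [hq3] at this; linarith
      | succ n =>
        change -q (n + 1 + 1) < -q (n + 1)
        have := hq1 (Nat.lt_succ_self (n + 1))
        simp only [Nat.succ_eq_add_one] at this
        linarith
  · ext x
    constructor
    · rintro ⟨z, rfl⟩
      cases z with
      | ofNat n => exact (hp n).1
      | negSucc n => exact (hq (n + 1)).1
    · intro hx
      rcases le_total 0 x with h | h
      · have : x ∈ Set.range p := by rw [hp2]; exact ⟨hx, h⟩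
        obtain ⟨n, hn⟩ := this
        exact ⟨Int.ofNat n, hn⟩
      · have : -x ∈ Set.range q := by rw [hq2]; exact ⟨by simpa using hx, by linarith⟩
        obtain ⟨n, hn⟩ := this
        cases n with
        | zero => exact ⟨0, by change p 0 = x; rw [hp3]; rw [hq3] at hn; linarith⟩
        | succ n => exact ⟨Int.negSucc n, by change -q (n + 1) = x; rw [hn]; ring⟩

/-- Gaps are only known to the right. Enumerating the part of S from y upwards reaches x at a
positive index, and the term before it is the predecessor of x. -/
theorem HasGaps.exists_prev {S : Set ℝ} {Δ : Fin 2 → ℝ} (hΔ : ∀ j, 0 < Δ j) (h : HasGaps S Δ)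
    {x y : ℝ} (hx : x ∈ S) (hy : y ∈ S) (hyx : y < x) :
    ∃ j, x - Δ j ∈ S ∧ ∀ z ∈ S, z < x → z ≤ x - Δ j := by
  obtain ⟨ε, hε, hεΔ⟩ := exists_pos_lower_bound hΔ
  obtain ⟨t, ht1, ht2, ht3⟩ := exists_nat_enumeration (S := {z | z + y ∈ S ∧ 0 ≤ z}) hε
    ⟨by simpa using hy, le_rfl⟩ (fun x hx => hx.2) (by
      rintro z ⟨hz, hz0⟩
      obtain ⟨j, hj1, hj2⟩ := h _ hz
      refine ⟨z + Δ j, ⟨?_, by linarith [hΔ j]⟩, by linarith [hεΔ j], fun w hw hzw => ?_⟩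
      · convert hj1 using 1; ring
      · linarith [hj2 _ hw.1 (by linarith)])
  have hxr : x - y ∈ Set.range t := by
    rw [ht2]
    exact ⟨by simpa using hx, by linarith⟩
  obtain ⟨n, hn⟩ := hxr
  cases n with
  | zero => rw [ht3] at hn; linarith
  | succ n =>
    have hmem : t n + y ∈ S ∧ 0 ≤ t n := by
      have : t n ∈ {z | z + y ∈ S ∧ 0 ≤ z} := ht2 ▸ Set.mem_range_self n
      exact this
    obtain ⟨j, hj1, hj2⟩ := h _ hmem.1
    have hlt := ht1 (Nat.lt_succ_self n)
    simp only [Nat.succ_eq_add_one] at hlt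
    have hj3 := hj2 x hx (by linarith)
    have hpred : ∀ z ∈ S, z < x → z ≤ t n + y := by
      intro z hz hzx
      by_contra! hlt'
      have : z - y ∈ Set.range t := by
        rw [ht2]
        exact ⟨by simpa using hz, by linarith [hmem.2]⟩
      obtain ⟨i, hi⟩ := this
      have h1 : n < i := ht1.lt_iff_lt.mp (by linarith)
      have h2 : i < n + 1 := ht1.lt_iff_lt.mp (by linarith)
      omega
    have hx' : t n + y + Δ j = x := by
      rcases hj3.lt_or_eq with h3 | h3
      · linarith [hpred _ hj1 h3, hΔ j]
      · exact h3
    refine ⟨j, ?_, fun z hz hzx => ?_⟩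
    · convert hmem.1 using 1; linarith
    · linarith [hpred z hz hzx]

/-- A set with gaps coded by letters that is unbounded on both sides is coded by a word. -/
theorem HasGaps.exists_codes {S : Set ℝ} {Δ : Fin 2 → ℝ} (hΔ : ∀ j, 0 < Δ j) (h : HasGaps S Δ)
    (h0 : 0 ∈ S) (hdown : ∀ x ∈ S, ∃ y ∈ S, y < x) : ∃ v, Codes S Δ v := by
  obtain ⟨ε, hε, hεΔ⟩ := exists_pos_lower_bound hΔ
  obtain ⟨t, ht⟩ := exists_enumerates hε h0
    (fun x hx _ => by
      obtain ⟨j, hj1, hj2⟩ := h x hx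
      exact ⟨_, hj1, by linarith [hεΔ j], hj2⟩)
    (fun x hx _ => by
      obtain ⟨y, hy, hyx⟩ := hdown x hx
      obtain ⟨j, hj1, hj2⟩ := h.exists_prev hΔ hx hy hyx
      exact ⟨_, hj1, by linarith [hεΔ j], hj2⟩)
  have hgap : ∀ j : ℤ, ∃ c, t (j + 1) - t j = Δ c := by
    intro j
    have hm : ∀ i, t i ∈ S := fun i => ht.2.1 ▸ Set.mem_range_self i
    obtain ⟨c, hc1, hc2⟩ := h _ (hm j)
    refine ⟨c, ?_⟩
    have h1 := hc2 _ (hm (j + 1)) (ht.1 (by omega))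
    have h2 : t j + Δ c ∈ Set.range t := by rw [ht.2.1]; exact hc1
    obtain ⟨i, hi⟩ := h2
    have h3 : j < i := ht.1.lt_iff_lt.mp (by linarith [hΔ c])
    have h4 : t (j + 1) ≤ t i := ht.1.monotone (by omega)
    linarith
  choose v hv using hgap
  exact ⟨v, t, ht, hv⟩

/-- The symmetric set of a set of non-negative numbers with coded gaps is coded on the right. -/
theorem HasGaps.exists_codesRight {S : Set ℝ} {Δ : Fin 2 → ℝ} (hΔ : ∀ j, 0 < Δ j)
    (h : HasGaps S Δ) (h0 : 0 ∈ S) (hS : ∀ x ∈ S, 0 ≤ x) :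
    ∃ u, CodesRight {x | x ∈ S ∨ -x ∈ S} Δ u := by
  obtain ⟨ε, hε, hεΔ⟩ := exists_pos_lower_bound hΔ
  -- To the right of a point of S the mirrored half contributes nothing.
  have hle : ∀ x y : ℝ, x ∈ S → (y ∈ S ∨ -y ∈ S) → x < y → y ∈ S := by
    rintro x y hx (hy | hy) hxy
    · exact hy
    · linarith [hS _ hx, hS _ hy]
  obtain ⟨t, ht⟩ := exists_enumerates (S := {x | x ∈ S ∨ -x ∈ S}) hε (Or.inl h0)
    (fun x hx hx0 => by
      have hx' : x ∈ S := by
        rcases hx with hx | hx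
        · exact hx
        · have : x = 0 := by linarith [hS _ hx]
          rwa [this]
      obtain ⟨j, hj1, hj2⟩ := h x hx'
      exact ⟨_, Or.inl hj1, by linarith [hεΔ j], fun z hz hxz => hj2 z (hle x z hx' hz hxz) hxz⟩)
    (fun x hx hx0 => by
      have hx' : -x ∈ S := by
        rcases hx with hx | hx
        · have : x = 0 := by linarith [hS _ hx]
          rw [this]; simpa using h0
        · exact hx
      obtain ⟨j, hj1, hj2⟩ := h _ hx'
      refine ⟨x - Δ j, Or.inr (by convert hj1 using 1; ring), by linarith [hεΔ j],
        fun z hz hxz => ?_⟩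
      have hz' : -z ∈ S := hle (-x) (-z) hx' (by simpa [or_comm] using hz) (by linarith)
      linarith [hj2 _ hz' (by linarith)])
  have hm : ∀ i : ℕ, t i ∈ S := by
    intro i
    have hi : t i ∈ {x | x ∈ S ∨ -x ∈ S} := ht.2.1 ▸ Set.mem_range_self _
    have hi0 : t 0 ≤ t i := ht.1.monotone (by omega)
    rw [ht.2.2] at hi0
    rcases hi with hi | hi
    · exact hi
    · have : t i = 0 := by linarith [hS _ hi]
      rwa [this]
  have hgap : ∀ j : ℕ, ∃ c, t ((j : ℤ) + 1) - t j = Δ c := by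
    intro j
    obtain ⟨c, hc1, hc2⟩ := h _ (hm j)
    refine ⟨c, ?_⟩
    have h1 := hc2 _ (hm (j + 1)) (ht.1 (by omega))
    have h2 : t j + Δ c ∈ Set.range t := by rw [ht.2.1]; exact Or.inl hc1
    obtain ⟨i, hi⟩ := h2
    have h3 : (j : ℤ) < i := ht.1.lt_iff_lt.mp (by linarith [hΔ c])
    have h4 : t (j + 1) ≤ t i := ht.1.monotone (by omega)
    push_cast at h1
    linarith
  choose u hu using hgap
  exact ⟨u, t, ht, hu⟩

end Enumeration

/-! ### Sets described by finite words -/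

/-- The lengths `1, δ` of the letters are positive. -/
theorem pair_pos {δ : ℝ} (hδ : 0 < δ) : ∀ j, 0 < (![1, δ] : Fin 2 → ℝ) j := by
  intro j
  fin_cases j
  · exact one_pos
  · exact hδ

theorem pair_injective {δ : ℝ} (hδ : δ ≠ 1) :
    Function.Injective (![1, δ] : Fin 2 → ℝ) := by
  intro i j h
  fin_cases i <;> fin_cases j <;> simp_all

/-- The set `S` of non-negative numbers consists of the left ends of all letters of the words
`W 0, W 1, W 2, ⋯` placed at the origin, each of them being a proper prefix of the next. -/
structure PosTiling (S : Set ℝ) (Δ : Fin 2 → ℝ) (W : ℕ → List (Fin 2)) : Prop where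
  ne_nil : ∀ k, W k ≠ []
  extend : ∀ k, ∃ Y, Y ≠ [] ∧ W (k + 1) = W k ++ Y
  mem_iff : ∀ x, x ∈ S ↔ ∃ k j, Occ Δ 0 (W k) x j

/-! ### Gaps and coding words of one-sided tilings. -/

namespace PosTiling

variable {S : Set ℝ} {Δ : Fin 2 → ℝ} {W : ℕ → List (Fin 2)}

theorem prefix_of_le (h : PosTiling S Δ W) {k K : ℕ} (hk : k ≤ K) : W k <+: W K := by
  induction K, hk using Nat.le_induction with
  | base => exact List.prefix_rfl
  | succ K _ ih =>
    obtain ⟨Y, -, hY⟩ := h.extend K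
    rw [hY]
    exact ih.trans (List.prefix_append _ _)

/-- The words are nested prefixes, so later ones add points only beyond the end of W k. -/
theorem initial (hΔ : ∀ j, 0 < Δ j) (h : PosTiling S Δ W) (k : ℕ) (x : ℝ) (hx : x ∈ S)
    (hk : x < wlen Δ (W k)) : ∃ j, Occ Δ 0 (W k) x j := by
  obtain ⟨K, j, hK⟩ := (h.mem_iff x).mp hx
  rcases le_total k K with hkK | hkK
  · obtain ⟨Y, hY⟩ := h.prefix_of_le hkK
    rw [← hY, occ_append] at hK
    rcases hK with hK | hK
    · exact ⟨j, hK⟩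
    · obtain ⟨f, g, -, rfl⟩ := occ_iff.mp hK
      linarith [wlen_nonneg hΔ f]
  · obtain ⟨Y, hY⟩ := h.prefix_of_le hkK
    rw [← hY]
    exact ⟨j, occ_append.mpr (Or.inl hK)⟩

theorem occ_zero {w : List (Fin 2)} (hw : w ≠ []) : ∃ j, Occ Δ 0 w 0 j := by
  cases w with
  | nil => exact absurd rfl hw
  | cons b w => exact ⟨b, Or.inl ⟨rfl, rfl⟩⟩

theorem zero_mem (h : PosTiling S Δ W) : 0 ∈ S :=
  (h.mem_iff 0).mpr ⟨0, occ_zero (h.ne_nil 0)⟩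

theorem nonneg (hΔ : ∀ j, 0 < Δ j) (h : PosTiling S Δ W) : ∀ x ∈ S, 0 ≤ x := by
  intro x hx
  obtain ⟨k, j, hk⟩ := (h.mem_iff x).mp hx
  obtain ⟨f, g, -, rfl⟩ := occ_iff.mp hk
  linarith [wlen_nonneg hΔ f]

theorem hasGaps (hΔ : ∀ j, 0 < Δ j) (h : PosTiling S Δ W) : HasGaps S Δ := by
  intro x hx
  obtain ⟨k, j, hk⟩ := (h.mem_iff x).mp hx
  obtain ⟨f, g, hf, hfx⟩ := occ_iff.mp hk
  -- The letter at x may be the last of W k; the next level guarantees a letter after it, whose left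
  -- end is the successor of x.
  obtain ⟨Y, hY, hkY⟩ := h.extend k
  have hW : W (k + 1) = f ++ j :: (g ++ Y) := by rw [hkY, hf]; simp
  obtain ⟨c, r, hcr⟩ : ∃ c r, g ++ Y = c :: r := by
    cases hg : g ++ Y with
    | nil => simp at hg; exact absurd hg.2 hY
    | cons c r => exact ⟨c, r, rfl⟩
  rw [hcr] at hW
  refine ⟨j, ?_, ?_⟩
  · refine (h.mem_iff _).mpr ⟨k + 1, c, occ_iff.mpr ⟨f ++ [j], r, by simp [hW], ?_⟩⟩
    rw [wlen_append, wlen_cons, wlen_nil]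
    linarith
  · intro z hz hxz
    by_contra! hlt
    have hzW : z < wlen Δ (W (k + 1)) := by
      rw [hW, wlen_append, wlen_cons, wlen_cons]
      linarith [wlen_nonneg hΔ r, hΔ c]
    obtain ⟨i, hi⟩ := h.initial hΔ _ z hz hzW
    obtain ⟨f', g', hf', hfz⟩ := occ_iff.mp hi
    obtain ⟨q, hq1, hq2⟩ := exists_append_of_wlen_le hΔ (hW.symm.trans hf') (by linarith)
    subst hq1
    cases q with
    | nil => simp at hfz; linarith
    | cons b q =>
      simp only [List.cons_append, List.cons.injEq] at hq2
      rw [← hq2.1, wlen_append, wlen_cons] at hfz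
      linarith [wlen_nonneg hΔ q]

variable {u : ℕ → Fin 2} {t : ℤ → ℝ}

/-- A coding word of the set starts with the words of the tiling. -/
theorem exists_append (hΔ : ∀ j, 0 < Δ j) (hinj : Function.Injective Δ) (h : PosTiling S Δ W)
    (ht : StrictMono t) (hm : ∀ x ∈ S, ∃ i, t i = x) (h0 : t 0 = 0)
    (hu : ∀ j : ℕ, t ((j : ℤ) + 1) - t (j : ℤ) = Δ (u j)) {k : ℕ} :
    ∀ N : ℕ, (∀ i : ℕ, i ≤ N → t i ∈ S) → t N < wlen Δ (W k) →
      ∃ g, W k = (List.range N).map u ++ g ∧ wlen Δ ((List.range N).map u) = t N := by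
  intro N
  induction N with
  | zero => intro _ _; exact ⟨W k, by simp, by simp [h0]⟩
  | succ N ih =>
    intro hS hN
    have hNN : t N < t ((N + 1 : ℕ) : ℤ) := ht (by omega)
    obtain ⟨g, hg, hl⟩ := ih (fun i hi => hS i (by omega)) (by linarith)
    obtain ⟨j, hj⟩ := h.initial hΔ k _ (hS _ le_rfl) hN
    obtain ⟨f', g', hf', hx⟩ := occ_iff.mp hj
    have huN := hu N
    push_cast at hx hNN huN ⊢
    obtain ⟨q, rfl, hq⟩ := exists_append_of_wlen_le hΔ (hg.symm.trans hf') (by linarith)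
    rw [wlen_append] at hx
    cases q with
    | nil => simp at hx; linarith
    | cons b q =>
      have hq0 : q = [] := by
        cases q with
        | nil => rfl
        | cons c q =>
          -- Two or more letters between t N and t (N + 1) would put an element of S strictly
          -- between consecutive terms.
          exfalso
          have hmem : t N + Δ b ∈ S := (h.mem_iff _).mpr ⟨k, c, occ_iff.mpr
            ⟨(List.range N).map u ++ [b], q ++ j :: g', by rw [hg, hq]; simp, by simp [hl]⟩⟩
          obtain ⟨i, hi⟩ := hm _ hmem
          rw [wlen_cons, wlen_cons] at hx
          have h1 : (N : ℤ) < i := ht.lt_iff_lt.mp (by linarith [hΔ b])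
          have h2 : i < (N : ℤ) + 1 := ht.lt_iff_lt.mp (by linarith [hΔ c, wlen_nonneg hΔ q])
          omega
      subst hq0
      rw [wlen_cons, wlen_nil] at hx
      -- The lengths of the letters differ, so the gap determines the letter.
      have hb : b = u N := hinj (by linarith)
      subst hb
      refine ⟨j :: g', ?_, ?_⟩
      · rw [hg, hq]; simp [List.range_succ]
      · simp [List.range_succ, hl]; linarith

/-- The prefixes of a coding word and the words of the tiling. -/
theorem prefixes (hΔ : ∀ j, 0 < Δ j) (hinj : Function.Injective Δ) (h : PosTiling S Δ W)
    (hu : CodesRight {x | x ∈ S ∨ -x ∈ S} Δ u) :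
    (∀ N, ∃ k, (List.range N).map u <+: W k) ∧ ∀ k, ∃ N, W k <+: (List.range N).map u := by
  obtain ⟨t, ⟨ht, hr, h0⟩, hu⟩ := hu
  have hS := h.nonneg hΔ
  have hm : ∀ x ∈ S, ∃ i, t i = x := fun x hx => by
    have : x ∈ Set.range t := hr ▸ Or.inl hx
    exact this
  have hmem : ∀ i : ℕ, t i ∈ S := by
    intro i
    have hi : t i ∈ {x | x ∈ S ∨ -x ∈ S} := hr ▸ Set.mem_range_self _
    have hi0 : t 0 ≤ t i := ht.monotone (by omega)
    rw [h0] at hi0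
    rcases hi with hi | hi
    · exact hi
    · have : t i = 0 := by linarith [hS _ hi]
      rw [this]; exact h.zero_mem
  have hlt : ∀ {k x j}, Occ Δ 0 (W k) x j → x < wlen Δ (W k) := by
    intro k x j hx
    obtain ⟨f, g, hf, rfl⟩ := occ_iff.mp hx
    rw [hf, wlen_append, wlen_cons]
    linarith [hΔ j, wlen_nonneg hΔ g]
  constructor
  · intro N
    obtain ⟨k, j, hk⟩ := (h.mem_iff _).mp (hmem N)
    obtain ⟨g, hg, -⟩ := exists_append hΔ hinj h ht hm h0 hu N (fun i _ => hmem i) (hlt hk)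
    exact ⟨k, g, hg.symm⟩
  · intro k
    obtain ⟨Y, hY, hkY⟩ := h.extend k
    obtain ⟨c, r, rfl⟩ : ∃ c r, Y = c :: r := by
      cases Y with
      | nil => exact absurd rfl hY
      | cons c r => exact ⟨c, r, rfl⟩
    -- The end of W k is itself an element of S, hence some t N; the prefix of u of length N then
    -- has the length of W k and equals it.
    have hocc : Occ Δ 0 (W (k + 1)) (wlen Δ (W k)) c :=
      occ_iff.mpr ⟨W k, r, hkY, zero_add _⟩
    obtain ⟨i, hi⟩ := hm _ ((h.mem_iff _).mpr ⟨_, _, hocc⟩)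
    have hi0 : 0 ≤ i := ht.le_iff_le.mp (by rw [h0, hi]; exact wlen_nonneg hΔ _)
    obtain ⟨N, rfl⟩ := Int.eq_ofNat_of_zero_le hi0
    obtain ⟨g, hg, hl⟩ := exists_append hΔ hinj h ht hm h0 hu N (fun i _ => hmem i)
      (k := k + 1) (by rw [hi]; exact hlt hocc)
    refine ⟨N, ?_⟩
    rw [(append_inj_of_wlen hΔ (hkY.symm.trans hg) (by rw [hl, hi])).1]

theorem mem_language_iff (hΔ : ∀ j, 0 < Δ j) (hinj : Function.Injective Δ)
    (h : PosTiling S Δ W) (hu : CodesRight {x | x ∈ S ∨ -x ∈ S} Δ u) (w : List (Fin 2)) :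
    w ∈ language u ↔ ∃ k, w <:+: W k := by
  obtain ⟨h1, h2⟩ := h.prefixes hΔ hinj hu
  rw [mem_language]
  constructor
  · rintro ⟨N, hN⟩
    obtain ⟨k, hk⟩ := h1 N
    exact ⟨k, hN.trans hk.isInfix⟩
  · rintro ⟨k, hk⟩
    obtain ⟨N, hN⟩ := h2 k
    exact ⟨N, hk.trans hN.isInfix⟩

end PosTiling

/-- The set `S` is the increasing union of the sets of left ends of the letters `0` in the words
`a k` placed at `s k`, where the letters have the lengths `1` and `δ`. -/
structure NegTiling (S : Set ℝ) (δ : ℝ) (a : ℕ → List (Fin 2)) (s : ℕ → ℝ) : Prop where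
  zero_mem : 0 ∈ S
  mono : ∀ k x, Occ ![1, δ] (s k) (a k) x 0 → Occ ![1, δ] (s (k + 1)) (a (k + 1)) x 0
  mem_iff : ∀ x, x ∈ S ↔ ∃ k, Occ ![1, δ] (s k) (a k) x 0
  convex : ∀ k x y, Occ ![1, δ] (s k) (a k) x 0 → Occ ![1, δ] (s k) (a k) y 0 →
    ∀ z ∈ S, x ≤ z → z ≤ y → Occ ![1, δ] (s k) (a k) z 0
  isolated : ∀ k, ¬ [1, 1] <:+: a k
  exists_gt : ∀ x ∈ S, ∃ y ∈ S, x < y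
  exists_lt : ∀ x ∈ S, ∃ y ∈ S, y < x
  sandwich : ∀ k, ∃ K X Y, a K = X ++ a k ++ Y ∧ 0 ∈ X ∧ 0 ∈ Y

/-! ### Gaps and coding words of two-sided tilings with filler letters. -/

namespace NegTiling

variable {S : Set ℝ} {δ : ℝ} {a : ℕ → List (Fin 2)} {s : ℕ → ℝ}

theorem mono_le (h : NegTiling S δ a s) {k K : ℕ} (hk : k ≤ K) {x : ℝ}
    (hx : Occ ![1, δ] (s k) (a k) x 0) : Occ ![1, δ] (s K) (a K) x 0 := by
  induction K, hk using Nat.le_induction with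
  | base => exact hx
  | succ K _ ih => exact h.mono _ _ ih

theorem exists_common (h : NegTiling S δ a s) {x y : ℝ} (hx : x ∈ S) (hy : y ∈ S) :
    ∃ k, Occ ![1, δ] (s k) (a k) x 0 ∧ Occ ![1, δ] (s k) (a k) y 0 := by
  obtain ⟨i, hi⟩ := (h.mem_iff x).mp hx
  obtain ⟨j, hj⟩ := (h.mem_iff y).mp hy
  exact ⟨max i j, h.mono_le (le_max_left _ _) hi, h.mono_le (le_max_right _ _) hj⟩

/-- No two letters 1 are adjacent, so a letter 0 with another 0 somewhere after it is followed by 0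
or by 10, which gives the gaps 1 and 1 + δ. Convexity ensures that no element of S between two coded
points is missed. -/
theorem hasGaps (hδ : 0 < δ) (h : NegTiling S δ a s) : HasGaps S ![1, 1 + δ] := by
  have hΔ := pair_pos hδ
  intro x hx
  obtain ⟨y, hy, hxy⟩ := h.exists_gt x hx
  obtain ⟨k, hkx, hky⟩ := h.exists_common hx hy
  obtain ⟨f, g, hf, hfx⟩ := occ_iff.mp hkx
  obtain ⟨f', g', hf', hfy⟩ := occ_iff.mp hky
  obtain ⟨q, rfl, hq⟩ := exists_append_of_wlen_le hΔ (hf.symm.trans hf') (by linarith)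
  have key : ∀ z ∈ S, x < z → z ≤ y → ∃ q r, g = q ++ 0 :: r ∧ z = x + 1 + wlen ![1, δ] q := by
    intro z hz hxz hzy
    obtain ⟨f₂, r, hf₂, hfz⟩ := occ_iff.mp (h.convex k x y hkx hky z hz hxz.le hzy)
    obtain ⟨q, rfl, hq⟩ := exists_append_of_wlen_le hΔ (hf.symm.trans hf₂) (by linarith)
    rw [wlen_append] at hfz
    cases q with
    | nil => simp at hfz; linarith
    | cons b q =>
      simp only [List.cons_append, List.cons.injEq] at hq
      refine ⟨q, r, hq.2, ?_⟩
      rw [← hfz, ← hfx, ← hq.1]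
      simp only [wlen_cons, Matrix.cons_val_zero]
      ring
  have hmem : ∀ q r, g = q ++ 0 :: r → x + 1 + wlen ![1, δ] q ∈ S := by
    intro q r hg
    refine (h.mem_iff _).mpr ⟨k, occ_iff.mpr ⟨f ++ 0 :: q, r, by rw [hf, hg]; simp, ?_⟩⟩
    rw [← hfx]
    simp only [wlen_append, wlen_cons, Matrix.cons_val_zero]
    ring
  obtain ⟨q, r, hg, hqy⟩ := key y hy hxy le_rfl
  have hcases : (∃ r, g = 0 :: r) ∨ ∃ r, g = 1 :: 0 :: r := by
    cases q with
    | nil => exact Or.inl ⟨r, hg⟩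
    | cons b q =>
      match b with
      | 0 => exact Or.inl ⟨_, hg⟩
      | 1 =>
        cases q with
        | nil => exact Or.inr ⟨r, hg⟩
        | cons c q =>
          match c with
          | 0 => exact Or.inr ⟨_, hg⟩
          | 1 =>
            exfalso
            refine h.isolated k ⟨f ++ [0], q ++ 0 :: r, ?_⟩
            rw [hf, hg]
            simp
  rcases hcases with ⟨r', hr'⟩ | ⟨r', hr'⟩
  · refine ⟨0, ?_, fun z hz hxz => ?_⟩
    · simpa using hmem [] r' hr'
    · rcases le_total z y with hzy | hzy
      · obtain ⟨q, r, -, rfl⟩ := key z hz hxz hzy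
        simp only [Matrix.cons_val_zero]
        linarith [wlen_nonneg hΔ q]
      · simp only [Matrix.cons_val_zero]
        linarith [wlen_nonneg hΔ q]
  · have hle : ∀ q r, g = q ++ 0 :: r → δ ≤ wlen ![1, δ] q := by
      intro q r hq
      rw [hr'] at hq
      cases q with
      | nil => simp at hq
      | cons b q =>
        simp only [List.cons_append, List.cons.injEq] at hq
        rw [← hq.1]
        simp only [wlen_cons, Matrix.cons_val_one, Matrix.cons_val_fin_one]
        linarith [wlen_nonneg hΔ q]
    refine ⟨1, ?_, fun z hz hxz => ?_⟩
    · have := hmem [1] r' hr'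
      simp only [wlen_cons, Matrix.cons_val_one, Matrix.cons_val_fin_one, wlen_nil] at this ⊢
      convert this using 1; ring
    · simp only [Matrix.cons_val_one, Matrix.cons_val_fin_one]
      rcases le_total z y with hzy | hzy
      · obtain ⟨q, r, hq, rfl⟩ := key z hz hxz hzy
        linarith [hle q r hq]
      · linarith [hle q r hg]

theorem exists_codes (hδ : 0 < δ) (h : NegTiling S δ a s) : ∃ v, Codes S ![1, 1 + δ] v :=
  (h.hasGaps hδ).exists_codes (pair_pos (by linarith)) h.zero_mem h.exists_lt

variable {v : ℤ → Fin 2} {t : ℤ → ℝ}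

/-- The word between two elements of the set that belong to the same word of the tiling. -/
theorem exists_append (hδ : 0 < δ) (hδ1 : δ < 1) (h : NegTiling S δ a s)
    (ht : Enumerates S t) (hv : ∀ j : ℤ, t (j + 1) - t j = ![1, 1 + δ] (v j)) {k : ℕ} {i : ℤ} :
    ∀ N : ℕ, Occ ![1, δ] (s k) (a k) (t i) 0 → Occ ![1, δ] (s k) (a k) (t (i + N)) 0 →
      ∃ f g, a k = f ++ (window v i N).flatMap morTilde ++ 0 :: g ∧
        s k + wlen ![1, δ] f = t i ∧
        s k + wlen ![1, δ] (f ++ (window v i N).flatMap morTilde) = t (i + N) := by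
  have hΔ := pair_pos hδ
  intro N
  induction N with
  | zero =>
    intro hi _
    obtain ⟨f, g, hf, hfx⟩ := occ_iff.mp hi
    exact ⟨f, g, by simp [hf], hfx, by simp [hfx]⟩
  | succ N ih =>
    intro hi hN
    have hmem : t (i + N) ∈ S := ht.2.1 ▸ Set.mem_range_self _
    have h1 : t i ≤ t (i + N) := ht.1.monotone (by omega)
    have h2 : t (i + N) < t (i + (N + 1 : ℕ)) := ht.1 (by omega)
    obtain ⟨f, g, hf, hfi, hfN⟩ := ih hi (h.convex k _ _ hi hN _ hmem h1 h2.le)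
    obtain ⟨f', g', hf', hfN'⟩ := occ_iff.mp hN
    obtain ⟨q, rfl, hq⟩ := exists_append_of_wlen_le hΔ (hf.symm.trans hf') (by linarith)
    have hgap := hv (i + N)
    have hcast : t (i + (N + 1 : ℕ)) = t (i + N + 1) := by push_cast; ring_nf
    rw [hcast] at hfN' h2 ⊢
    rw [wlen_append] at hfN'
    cases q with
    | nil => simp at hfN'; simp at hfN; linarith
    | cons b q =>
      simp only [List.cons_append, List.cons.injEq] at hq
      obtain ⟨rfl, rfl⟩ := hq
      simp only [wlen_cons, Matrix.cons_val_zero] at hfN'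
      -- The length of the gap leaves 0 or δ for q; since δ < 1, a remainder δ contains no letter 0
      -- and must be the single letter 1.
      have hq : 0 :: q = morTilde (v (i + N)) := by
        generalize v (i + N) = c at hgap
        match c with
        | 0 =>
          simp only [Matrix.cons_val_zero] at hgap
          rw [eq_nil_of_wlen hΔ (w := q) (by linarith)]
          rfl
        | 1 =>
          simp only [Matrix.cons_val_one, Matrix.cons_val_fin_one] at hgap
          have hql : wlen ![1, δ] q = δ := by linarith
          cases q with
          | nil => simp at hql; linarith
          | cons c q =>
            match c with
            | 0 =>
              simp only [wlen_cons, Matrix.cons_val_zero] at hql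
              linarith [wlen_nonneg hΔ q]
            | 1 =>
              simp only [wlen_cons, Matrix.cons_val_one, Matrix.cons_val_fin_one] at hql
              rw [eq_nil_of_wlen hΔ (w := q) (by linarith)]
              rfl
      refine ⟨f, g', ?_, hfi, ?_⟩
      · rw [hf', window_succ, List.flatMap_append, List.flatMap_cons, List.flatMap_nil, ← hq]
        simp
      · rw [window_succ, List.flatMap_append, List.flatMap_cons, List.flatMap_nil, ← hq,
          ← List.append_assoc, wlen_append, List.append_nil, ← hfN']
        simp only [wlen_cons, Matrix.cons_val_zero]

/-- The language of the tiled line. -/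
theorem mem_languageZ_iff (hδ : 0 < δ) (hδ1 : δ < 1) (h : NegTiling S δ a s)
    (hv : Codes S ![1, 1 + δ] v) (w : List (Fin 2)) :
    w ∈ languageZ (imageZ morTilde morTilde_ne_nil v) ↔ ∃ k, w <:+: a k := by
  have hΔ := pair_pos hδ
  obtain ⟨t, ht, hv⟩ := hv
  have hm : ∀ i, t i ∈ S := fun i => ht.2.1 ▸ Set.mem_range_self _
  rw [mem_languageZ_imageZ]
  constructor
  · rintro ⟨i, N, hw⟩
    obtain ⟨k, h1, h2⟩ := h.exists_common (hm i) (hm (i + N))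
    obtain ⟨f, g, hf, -⟩ := h.exists_append hδ hδ1 ht hv N h1 h2
    exact ⟨k, hw.trans ⟨f, 0 :: g, hf.symm⟩⟩
  · rintro ⟨k, hw⟩
    -- A factor of a k may begin or end in filler. Enclosed between two letters 0 of a larger word
    -- it lies between two elements of S, where `exists_append` applies.
    obtain ⟨K, X, Y, hK, hX, hY⟩ := h.sandwich k
    obtain ⟨X₁, X₂, rfl⟩ := List.append_of_mem hX
    obtain ⟨Y₁, Y₂, rfl⟩ := List.append_of_mem hY
    have hK1 : a K = X₁ ++ 0 :: (X₂ ++ a k ++ Y₁ ++ 0 :: Y₂) := by rw [hK]; simp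
    have hK2 : a K = (X₁ ++ 0 :: (X₂ ++ a k ++ Y₁)) ++ 0 :: Y₂ := by rw [hK]; simp
    have ho1 : Occ ![1, δ] (s K) (a K) (s K + wlen ![1, δ] X₁) 0 :=
      occ_iff.mpr ⟨_, _, hK1, rfl⟩
    have ho2 : Occ ![1, δ] (s K) (a K)
        (s K + wlen ![1, δ] (X₁ ++ 0 :: (X₂ ++ a k ++ Y₁))) 0 := occ_iff.mpr ⟨_, _, hK2, rfl⟩
    have hr1 : s K + wlen ![1, δ] X₁ ∈ Set.range t := by
      rw [ht.2.1]; exact (h.mem_iff _).mpr ⟨K, ho1⟩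
    have hr2 : s K + wlen ![1, δ] (X₁ ++ 0 :: (X₂ ++ a k ++ Y₁)) ∈ Set.range t := by
      rw [ht.2.1]; exact (h.mem_iff _).mpr ⟨K, ho2⟩
    obtain ⟨i, hi⟩ := hr1
    obtain ⟨j, hj⟩ := hr2
    have hij : i ≤ j := by
      apply ht.1.le_iff_le.mp
      rw [hi, hj, wlen_append]
      linarith [wlen_nonneg hΔ (0 :: (X₂ ++ a k ++ Y₁))]
    obtain ⟨N, rfl⟩ := Int.le.dest hij
    obtain ⟨f, g, hf, hfi, hfj⟩ := h.exists_append hδ hδ1 ht hv (k := K) (i := i) N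
      (by rw [hi]; exact ho1) (by rw [hj]; exact ho2)
    have e1 : f = X₁ := by
      rw [List.append_assoc] at hf
      exact (append_inj_of_wlen hΔ (hf.symm.trans hK1) (by linarith)).1
    have e2 := (append_inj_of_wlen hΔ (hf.symm.trans hK2) (by linarith)).1
    rw [e1, List.append_cancel_left_eq] at e2
    refine ⟨i, N, hw.trans ?_⟩
    rw [e2]
    exact ⟨0 :: X₂, Y₁, by simp⟩

/-- If the words to the right of the origin start with prefixes of a word coding a set of
non-negative numbers, then this word is the image of the right part under `0 ↦ 0, 1 ↦ 10`. -/
theorem eq_image_rightPart (hδ : 0 < δ) (hδ1 : δ < 1) (h : NegTiling S δ a s)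
    (hv : Codes S ![1, 1 + δ] v) {u : ℕ → Fin 2}
    (hu : ∀ k, ∃ K f y N, k ≤ K ∧ a K = f ++ 0 :: y ∧ s K + wlen ![1, δ] f = 0 ∧
      y <+: (List.range N).map u) :
    u = image mor mor_ne_nil (rightPart v) := by
  have hΔ := pair_pos hδ
  obtain ⟨t, ht, hv⟩ := hv
  have hm : ∀ i, t i ∈ S := fun i => ht.2.1 ▸ Set.mem_range_self _
  have key : ∀ N, ∃ L, imagePrefix mor (rightPart v) N <+: (List.range L).map u := by
    intro N
    obtain ⟨k, h1, h2⟩ := h.exists_common (hm 0) (hm (0 + N))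
    obtain ⟨K, f, y, L, hkK, hf, hf0, hy⟩ := hu k
    obtain ⟨f', g, hf', hfi, -⟩ := h.exists_append hδ hδ1 ht hv N (h.mono_le hkK h1)
      (h.mono_le hkK h2)
    refine ⟨L, List.IsPrefix.trans ?_ hy⟩
    rw [List.append_assoc] at hf'
    have e := (append_inj_of_wlen hΔ (hf'.symm.trans hf) (by rw [ht.2.2] at hfi; linarith)).2
    -- The letter 0 at t N is borrowed to turn π̃ into π; the 0 that appears in front is the letter
    -- at the origin and cancels.
    have e2 : (window v 0 N).flatMap morTilde ++ 0 :: g =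
        ((window v 0 N).flatMap morTilde ++ [0]) ++ g := by simp
    rw [e2, flatMap_morTilde_append, List.cons_append, List.cons.injEq] at e
    refine ⟨g, ?_⟩
    rw [← e.2, imagePrefix_eq_flatMap]
    simp only [window, zero_add]
    rfl
  funext i
  obtain ⟨L, r, hL⟩ := key (i + 1)
  have hi : i < (imagePrefix mor (rightPart v) (i + 1)).length :=
    le_length_imagePrefix mor mor_ne_nil (rightPart v) (i + 1)
  have hiL : i < L := by
    have := congrArg List.length hL
    simp at this
    omega
  have e : (imagePrefix mor (rightPart v) (i + 1) ++ r)[i]? = ((List.range L).map u)[i]? := by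
    rw [hL]
  rw [List.getElem?_append_left hi, List.getElem?_eq_getElem hi] at e
  simp [hiL] at e
  exact e.symm

end NegTiling

end BetaInt
namespace BetaInt

/-! ### The transformations and their finite orbits -/

section Transformation

variable {α l : ℝ}

theorem T_mem (α l x : ℝ) : T α l x ∈ Set.Ico l (l + 1) := by
  have h1 := Int.floor_le (α * x - l)
  have h2 := Int.lt_floor_add_one (α * x - l)
  constructor <;> simp only [T] <;> linarith

theorem T_eq {x : ℝ} (d : ℤ) (h : α * x - d ∈ Set.Ico l (l + 1)) : T α l x = α * x - d := by
  have : ⌊α * x - l⌋ = d := by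
    rw [Int.floor_eq_iff]
    constructor <;> linarith [h.1, h.2]
  rw [T, this]

theorem T_iterate_mem {x : ℝ} (hx : x ∈ Set.Ico l (l + 1)) (k : ℕ) :
    (T α l)^[k] x ∈ Set.Ico l (l + 1) := by
  cases k with
  | zero => exact hx
  | succ k => rw [Function.iterate_succ_apply']; exact T_mem _ _ _

theorem T_iterate_zero (hl : l ≤ 0) (hl' : 0 < l + 1) (k : ℕ) : (T α l)^[k] 0 = 0 := by
  induction k with
  | zero => rfl
  | succ k ih =>
    rw [Function.iterate_succ_apply, T_eq 0 (by simp [hl, hl'])]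
    simpa using ih

/-- The points of `[l, l+1)` that are sent to `0` by the `k`-th power of the transformation. -/
def zeroSet (α l : ℝ) (k : ℕ) : Set ℝ := {y | y ∈ Set.Ico l (l + 1) ∧ (T α l)^[k] y = 0}

theorem mem_zeroSet_zero (hl : l ≤ 0) (hl' : 0 < l + 1) {y : ℝ} : y ∈ zeroSet α l 0 ↔ y = 0 := by
  constructor
  · exact fun h => h.2
  · rintro rfl
    exact ⟨⟨hl, hl'⟩, rfl⟩

theorem zero_mem_zeroSet (hl : l ≤ 0) (hl' : 0 < l + 1) (k : ℕ) : 0 ∈ zeroSet α l k :=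
  ⟨⟨hl, hl'⟩, T_iterate_zero hl hl' k⟩

theorem mem_zeroSet_succ {k : ℕ} {y : ℝ} :
    y ∈ zeroSet α l (k + 1) ↔ y ∈ Set.Ico l (l + 1) ∧ ∃ d : ℤ, α * y - d ∈ zeroSet α l k := by
  constructor
  · rintro ⟨hy, h⟩
    rw [Function.iterate_succ_apply] at h
    exact ⟨hy, ⌊α * y - l⌋, T_mem α l y, h⟩
  · rintro ⟨hy, d, hd, h⟩
    refine ⟨hy, ?_⟩
    rw [Function.iterate_succ_apply, T_eq d hd]
    exact h

/-- With all digits zero, T acts as multiplication by α, and a nonzero orbit would leave the bounded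
interval. -/
theorem eq_zero_of_digits (hα : 1 < |α|) {z : ℝ} (hl : l ≤ 0) (hl' : 0 < l + 1)
    (hz : z ∈ Set.Ico l (l + 1)) (h : ∀ i, digit α l z i = 0) : z = 0 := by
  have hi : ∀ i, (T α l)^[i] z = α ^ i * z := by
    intro i
    induction i with
    | zero => simp
    | succ i ih =>
      have hd := h i
      rw [digit] at hd
      rw [Function.iterate_succ_apply', T, hd, ih]
      push_cast
      ring
  by_contra hne
  obtain ⟨i, hi'⟩ := pow_unbounded_of_one_lt (1 / |z|) hα
  have h1 := T_iterate_mem (α := α) hz i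
  rw [hi] at h1
  have h2 : |α ^ i * z| ≤ 1 := abs_le.mpr ⟨by linarith [h1.1], by linarith [h1.2]⟩
  rw [abs_mul, abs_pow] at h2
  have h3 := (div_lt_iff₀ (abs_pos.mpr hne)).mp hi'
  linarith

theorem digit_iterate (z : ℝ) (k i : ℕ) :
    digit α l ((T α l)^[k] z) i = digit α l z (i + k) := by
  rw [digit, digit, Function.iterate_add_apply]

/-- An expansion has no fractional part if and only if the orbit of the starting point gets to `0`
after reading the integral part. -/
theorem hasIntegerExpansion_iff (hα : 1 < |α|) (hl : l ≤ 0) (hl' : 0 < l + 1) {J : Set ℝ}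
    (hJ : J ⊆ Set.Ico l (l + 1)) (x : ℝ) :
    HasIntegerExpansion α l J x ↔ ∃ k : ℕ, x / α ^ k ∈ J ∧ x / α ^ k ∈ zeroSet α l k := by
  constructor
  · rintro ⟨k, hk, h⟩
    rcases le_total 0 k with hk0 | hk0
    · obtain ⟨K, rfl⟩ := Int.eq_ofNat_of_zero_le hk0
      rw [zpow_natCast] at hk h
      refine ⟨K, hk, hJ hk, eq_zero_of_digits hα hl hl' (T_iterate_mem (hJ hk) K) fun i => ?_⟩
      rw [digit_iterate]
      exact h _ (by omega)
    -- For k ≤ 0 every digit vanishes, so x = 0 and the exponent 0 serves as well.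
    · have hz := eq_zero_of_digits hα hl hl' (hJ hk) fun i => h i (by omega)
      have hα0 : α ≠ 0 := by
        rintro rfl
        norm_num at hα
      have hx : x = 0 := by
        rcases div_eq_zero_iff.mp hz with h0 | h0
        · exact h0
        · exact absurd h0 (zpow_ne_zero _ hα0)
      rw [hz] at hk
      subst hx
      exact ⟨0, by simpa using hk, by simpa using zero_mem_zeroSet hl hl' 0⟩
  · rintro ⟨k, hk, -, h⟩
    refine ⟨k, by rwa [zpow_natCast], fun i hi => ?_⟩
    obtain ⟨j, rfl⟩ := Nat.exists_eq_add_of_le' (Int.ofNat_le.mp hi)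
    rw [zpow_natCast, ← digit_iterate, h, digit, T_iterate_zero hl hl', mul_zero, zero_sub,
      Int.floor_eq_iff]
    constructor <;> push_cast <;> linarith

end Transformation

/-! ### Positive base -/

section Positive

variable {β δ : ℝ} {M : ℕ}

theorem posIntegers_iff (hβ : 1 < β) {x : ℝ} :
    x ∈ posIntegers β ↔ ∃ k : ℕ, x / β ^ k ∈ zeroSet β 0 k := by
  have hsub : Set.Ico (0 : ℝ) 1 ⊆ Set.Ico 0 (0 + 1) := by simp
  have habs : 1 < |β| := by rwa [abs_of_pos (by linarith)]
  rw [posIntegers, Set.mem_ofPred_eq, hasIntegerExpansion_iff habs le_rfl (by norm_num) hsub]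
  constructor
  · rintro ⟨-, k, -, h⟩
    exact ⟨k, h⟩
  · rintro ⟨k, h⟩
    have h1 := h.1
    rw [zero_add] at h1
    refine ⟨?_, k, h1, h⟩
    have := h1.1
    have hp : 0 < β ^ k := pow_pos (by linarith) k
    calc (0 : ℝ) ≤ x / β ^ k * β ^ k := mul_nonneg this hp.le
      _ = x := div_mul_cancel₀ _ hp.ne'

/-- Since y < 1 means βy < M + δ, the leading digits below M leave the remainder free, and the digit
M forces it below δ. -/
theorem mem_zeroSet_pos_succ (hβ : 1 < β) (hM : β = M + δ) (hδ0 : 0 ≤ δ) (hδ : δ < 1)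
    {k : ℕ} {y : ℝ} :
    y ∈ zeroSet β 0 (k + 1) ↔ (∃ d : ℕ, d < M ∧ β * y - d ∈ zeroSet β 0 k) ∨
      (β * y - M ∈ zeroSet β 0 k ∧ β * y - M < δ) := by
  rw [mem_zeroSet_succ]
  constructor
  · rintro ⟨⟨hy0, hy1⟩, d, hd⟩
    have h0 := hd.1.1
    have h1 := hd.1.2
    have hby : 0 ≤ β * y := mul_nonneg (by linarith) hy0
    have hby1 : β * y < β := by nlinarith
    have hd0 : -1 < d := by
      have : (-1 : ℝ) < d := by linarith
      exact_mod_cast this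
    obtain ⟨e, rfl⟩ := Int.eq_ofNat_of_zero_le (show 0 ≤ d by omega)
    have heM : e < M + 1 := by
      have : (e : ℝ) < M + 1 := by push_cast at h0; linarith
      exact_mod_cast this
    rcases Nat.lt_succ_iff_lt_or_eq.mp heM with h | rfl
    · exact Or.inl ⟨e, h, by simpa using hd⟩
    · exact Or.inr ⟨by simpa using hd, by linarith⟩
  · have hpos : ∀ c : ℝ, 0 ≤ c → c < β → c = β * y → y ∈ Set.Ico (0 : ℝ) (0 + 1) := by
      rintro c hc hcβ rfl
      rw [zero_add]
      exact ⟨nonneg_of_mul_nonneg_right hc (by linarith), by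
        by_contra! h
        nlinarith⟩
    rintro (⟨d, hd, h⟩ | ⟨h, hlt⟩)
    · have h0 := h.1.1
      have h1 := h.1.2
      have hd' : (d : ℝ) + 1 ≤ M := by exact_mod_cast hd
      have hd0 : (0 : ℝ) ≤ d := Nat.cast_nonneg d
      exact ⟨hpos (β * y) (by linarith) (by linarith) rfl, d, by simpa using h⟩
    · have h0 := h.1.1
      exact ⟨hpos (β * y) (by linarith [(Nat.cast_nonneg M : (0 : ℝ) ≤ M)]) (by linarith) rfl, M,
        by simpa using h⟩

end Positive

/-! ### Negative base -/

section Negative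

variable {β δ : ℝ} {M : ℕ}

/-- This identity characterizes l: multiplication by -β maps [l, l+1) onto (l, l+β]. -/
theorem negLeft_eq (hβ : 1 < β) : -β * negLeft β = negLeft β + β := by
  have : β + 1 ≠ 0 := by linarith
  rw [negLeft]
  field_simp
  ring

theorem negLeft_neg (hβ : 1 < β) : negLeft β < 0 :=
  div_neg_of_neg_of_pos (by linarith) (by linarith)

theorem negLeft_add_one_pos (hβ : 1 < β) : 0 < negLeft β + 1 := by
  have : negLeft β + 1 = 1 / (β + 1) := by
    rw [negLeft]
    field_simp
    ring
  rw [this]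
  positivity

/-- The two points `l` and `T l = l + δ` form a set that is closed under the transformation and
does not contain `0`. -/
theorem notMem_zeroSet_neg (hβ : 1 < β) (hM : β = M + δ) (hδ : 0 ≤ δ) (hδ' : δ < 1)
    (h0 : negLeft β + δ ≠ 0)
    (hT : T (-β) (negLeft β) (negLeft β + δ) = negLeft β + δ ∨
      T (-β) (negLeft β) (negLeft β + δ) = negLeft β) (k : ℕ) :
    negLeft β ∉ zeroSet (-β) (negLeft β) k ∧ negLeft β + δ ∉ zeroSet (-β) (negLeft β) k := by
  have hl := negLeft_eq hβ
  have hTl : T (-β) (negLeft β) (negLeft β) = negLeft β + δ := by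
    have h1 : -β * negLeft β - ((M : ℤ) : ℝ) = negLeft β + δ := by push_cast; linarith
    rw [T_eq (M : ℤ) (by rw [h1]; constructor <;> linarith), h1]
  have key : ∀ k, (T (-β) (negLeft β))^[k] (negLeft β) ≠ 0 ∧
      (T (-β) (negLeft β))^[k] (negLeft β + δ) ≠ 0 := by
    intro k
    induction k with
    | zero => exact ⟨(negLeft_neg hβ).ne, h0⟩
    | succ k ih =>
      rw [Function.iterate_succ_apply, Function.iterate_succ_apply, hTl]
      refine ⟨ih.2, ?_⟩
      rcases hT with h | h
      · rw [h]; exact ih.2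
      · rw [h]; exact ih.1
  exact ⟨fun h => (key k).1 h.2, fun h => (key k).2 h.2⟩

/-- Here -βy ranges over (l, l+M+δ], closed at the wrong end. The two boundary remainders l and l+δ
never reach 0, so the strict and weak inequalities may be exchanged. -/
theorem mem_zeroSet_neg_succ (hβ : 1 < β) (hM : β = M + δ) (hδ : 0 < δ) (hδ' : δ < 1) {k : ℕ}
    (hk : negLeft β ∉ zeroSet (-β) (negLeft β) k ∧
      negLeft β + δ ∉ zeroSet (-β) (negLeft β) k) {y : ℝ} :
    y ∈ zeroSet (-β) (negLeft β) (k + 1) ↔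
      (∃ d : ℕ, d < M ∧ -β * y - d ∈ zeroSet (-β) (negLeft β) k) ∨
      (-β * y - M ∈ zeroSet (-β) (negLeft β) k ∧ -β * y - M < negLeft β + δ) := by
  have hl := negLeft_eq hβ
  rw [mem_zeroSet_succ]
  constructor
  · rintro ⟨⟨hy0, hy1⟩, d, hd⟩
    have h0 := hd.1.1
    have h1 := hd.1.2
    have hb0 : -β * y ≤ negLeft β + β := by nlinarith
    have hb1 : negLeft β < -β * y := by nlinarith
    have hd0 : -1 < d := by
      have : (-1 : ℝ) < d := by linarith
      exact_mod_cast this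
    obtain ⟨e, rfl⟩ := Int.eq_ofNat_of_zero_le (show 0 ≤ d by omega)
    simp only [Int.cast_natCast] at h0 h1 hd
    have heM : e < M + 1 := by
      have : (e : ℝ) < M + 1 := by linarith
      exact_mod_cast this
    rcases Nat.lt_succ_iff_lt_or_eq.mp heM with h | rfl
    · exact Or.inl ⟨e, h, hd⟩
    · refine Or.inr ⟨hd, lt_of_le_of_ne (by linarith) fun h => ?_⟩
      rw [h] at hd
      exact hk.2 hd
  · have hmem : negLeft β < -β * y → -β * y ≤ negLeft β + β →
        y ∈ Set.Ico (negLeft β) (negLeft β + 1) := by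
      intro h1 h2
      constructor
      · by_contra! h
        nlinarith
      · by_contra! h
        nlinarith
    rintro (⟨d, hd, h⟩ | ⟨h, hlt⟩)
    · have h0 := h.1.1
      have h1 := h.1.2
      have hd' : (d : ℝ) + 1 ≤ M := by exact_mod_cast hd
      have hd0 : (0 : ℝ) ≤ d := Nat.cast_nonneg d
      have hne : -β * y - d ≠ negLeft β := fun h' => hk.1 (h' ▸ h)
      have hlt := lt_of_le_of_ne h0 hne.symm
      exact ⟨hmem (by linarith) (by linarith), d, by simpa using h⟩
    · have h0 := h.1.1
      have hM0 : (0 : ℝ) < M := by linarith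
      exact ⟨hmem (by linarith) (by linarith), M, by simpa using h⟩

/-- The starting point must avoid l, which is automatic because the orbit of l never reaches 0. -/
theorem negBetaIntegers_iff (hβ : 1 < β)
    (hk : ∀ k, negLeft β ∉ zeroSet (-β) (negLeft β) k) {x : ℝ} :
    x ∈ negBetaIntegers β ↔ ∃ k : ℕ, x / (-β) ^ k ∈ zeroSet (-β) (negLeft β) k := by
  have habs : 1 < |-β| := by rwa [abs_neg, abs_of_pos (by linarith)]
  rw [negBetaIntegers, Set.mem_ofPred_eq, hasIntegerExpansion_iff habs (negLeft_neg hβ).le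
    (negLeft_add_one_pos hβ) Set.Ioo_subset_Ico_self]
  constructor
  · rintro ⟨k, -, h⟩
    exact ⟨k, h⟩
  · rintro ⟨k, h⟩
    refine ⟨k, ⟨lt_of_le_of_ne h.1.1 fun h' => hk k (h' ▸ h), h.1.2⟩, h⟩

theorem neg_pow_ne (hβ : 1 < β) (k : ℕ) : (-β) ^ k ≠ 0 := pow_ne_zero _ (by linarith)

theorem div_neg_pow_succ (hβ : 1 < β) (k : ℕ) (x d : ℝ) :
    -β * (x / (-β) ^ (k + 1)) - d = (x - d * (-β) ^ k) / (-β) ^ k := by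
  have h1 := neg_pow_ne hβ k
  have h2 : -β ≠ 0 := by linarith
  rw [pow_succ]
  field_simp

/-- Membership in the sets of integers with expansions of bounded length does not depend on the
bound as long as the starting point is admitted. -/
theorem mem_zeroSet_of_le (hβ : 1 < β) {k : ℕ} {x : ℝ}
    (hx : x / (-β) ^ k ∈ Set.Ioo (negLeft β) (negLeft β + 1)) {K : ℕ} (hK : k ≤ K)
    (h : x / (-β) ^ K ∈ zeroSet (-β) (negLeft β) K) :
    x / (-β) ^ k ∈ zeroSet (-β) (negLeft β) k := by
  have hl := negLeft_eq hβ
  have hl0 := negLeft_neg hβ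
  have hl1 := negLeft_add_one_pos hβ
  -- Division by -β keeps the open interval (l, l+1) inside itself.
  have hmem : ∀ j, k ≤ j → x / (-β) ^ j ∈ Set.Ioo (negLeft β) (negLeft β + 1) := by
    intro j hj
    induction j, hj using Nat.le_induction with
    | base => exact hx
    | succ j _ ih =>
      have h1 := div_neg_pow_succ hβ j x 0
      simp only [sub_zero, zero_mul] at h1
      rw [← h1] at ih
      obtain ⟨ih1, ih2⟩ := ih
      constructor
      · by_contra! h; nlinarith
      · by_contra! h; nlinarith
  induction K, hK using Nat.le_induction with
  | base => exact h
  | succ K hkK ih =>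
    apply ih
    have h1 := div_neg_pow_succ hβ K x 0
    simp only [sub_zero, zero_mul] at h1
    have h2 := hmem K hkK
    refine ⟨⟨h2.1.le, h2.2⟩, ?_⟩
    have h3 := h.2
    -- Both quotients being admitted, the leading digit is 0 and can be dropped.
    rw [Function.iterate_succ_apply, T_eq 0 (by
      rw [Int.cast_zero, sub_zero, h1]; exact ⟨h2.1.le, h2.2⟩), Int.cast_zero, sub_zero, h1] at h3
    exact h3

end Negative

end BetaInt
namespace BetaInt

/-! ### The words of the positive base -/

section PositiveWords

variable {β δ : ℝ} {M : ℕ}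

/-- The words `W` and `V` code the integers of `[0, β^k)` and of `[0, δ β^k)`. -/
structure PosCoding (β δ : ℝ) (k : ℕ) (W V : List (Fin 2)) : Prop where
  first : ∀ x, (∃ j, Occ ![1, δ] 0 W x j) ↔ x / β ^ k ∈ zeroSet β 0 k
  second : ∀ x, (∃ j, Occ ![1, δ] 0 V x j) ↔ x / β ^ k ∈ zeroSet β 0 k ∧ x / β ^ k < δ
  length_first : wlen ![1, δ] W = β ^ k
  length_second : wlen ![1, δ] V = δ * β ^ k

theorem div_pow_succ (hβ : 1 < β) (k : ℕ) (x d : ℝ) :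
    β * (x / β ^ (k + 1)) - d = (x - d * β ^ k) / β ^ k := by
  have h1 : β ^ k ≠ 0 := pow_ne_zero _ (by linarith)
  have h2 : β ≠ 0 := by linarith
  rw [pow_succ]
  field_simp

theorem posCoding_zero (hδ : 0 < δ) : PosCoding β δ 0 [0] [1] where
  first x := by
    rw [pow_zero, div_one, mem_zeroSet_zero le_rfl (by norm_num)]
    simp [Occ]
  second x := by
    rw [pow_zero, div_one, mem_zeroSet_zero le_rfl (by norm_num)]
    simp only [Occ, or_false]
    constructor
    · rintro ⟨j, rfl, -⟩
      exact ⟨rfl, hδ⟩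
    · rintro ⟨rfl, -⟩
      exact ⟨1, rfl, rfl⟩
  length_first := by simp
  length_second := by simp

namespace PosCoding

variable {k : ℕ} {W V : List (Fin 2)}

theorem exists_occ_lpow (h : PosCoding β δ k W V) (N : ℕ) (x : ℝ) :
    (∃ j, Occ ![1, δ] 0 (lpow W N) x j) ↔
      ∃ d : ℕ, d < N ∧ (x - d * β ^ k) / β ^ k ∈ zeroSet β 0 k := by
  have h1 : ∀ j, Occ ![1, δ] 0 (lpow W N) x j ↔ ∃ d : ℕ, 0 ≤ d ∧ d < 0 + N ∧
      Occ ![1, δ] 0 W (x - d * β ^ k) j :=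
    fun j => occ_lpow_up h.length_first (by simp)
  simp only [h1, ← h.first, zero_add, zero_le, true_and]
  constructor
  · rintro ⟨j, d, hd, h⟩; exact ⟨d, hd, j, h⟩
  · rintro ⟨d, hd, j, h⟩; exact ⟨j, d, hd, h⟩

theorem exists_occ_lpow_append (h : PosCoding β δ k W V) (N : ℕ) (x : ℝ) :
    (∃ j, Occ ![1, δ] 0 (lpow W N ++ V) x j) ↔
      (∃ d : ℕ, d < N ∧ (x - d * β ^ k) / β ^ k ∈ zeroSet β 0 k) ∨
      ((x - N * β ^ k) / β ^ k ∈ zeroSet β 0 k ∧ (x - N * β ^ k) / β ^ k < δ) := by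
  simp only [occ_append, exists_or, h.exists_occ_lpow, ← h.second, occ_sub, wlen_lpow,
    h.length_first]

/-- The interval [0, β^{k+1}) consists of M translates of [0, β^k) followed by one of [0, δβ^k). -/
theorem succ_first (hβ : 1 < β) (hM : β = M + δ) (hδ : 0 < δ) (hδ' : δ < 1)
    (h : PosCoding β δ k W V) (x : ℝ) :
    (∃ j, Occ ![1, δ] 0 (lpow W M ++ V) x j) ↔ x / β ^ (k + 1) ∈ zeroSet β 0 (k + 1) := by
  rw [mem_zeroSet_pos_succ hβ hM hδ.le hδ', h.exists_occ_lpow_append]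
  simp only [div_pow_succ hβ]

theorem length_succ_first (hM : β = M + δ) (h : PosCoding β δ k W V) :
    wlen ![1, δ] (lpow W M ++ V) = β ^ (k + 1) := by
  rw [wlen_append, wlen_lpow, h.length_first, h.length_second, pow_succ]
  linear_combination -(β ^ k) * hM

/-- The digits of `1` in base `β` are `M, n`. -/
theorem succ_of_finite (hβ : 1 < β) (hM : β = M + δ) (hδ : 0 < δ) (hδ' : δ < 1) {n : ℕ}
    (hn : n ≤ M) (hβδ : β * δ = n) (h : PosCoding β δ k W V) :
    PosCoding β δ (k + 1) (lpow W M ++ V) (lpow W n) where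
  first := h.succ_first hβ hM hδ hδ'
  second x := by
    rw [mem_zeroSet_pos_succ hβ hM hδ.le hδ', h.exists_occ_lpow]
    simp only [← div_pow_succ hβ]
    generalize x / β ^ (k + 1) = y
    -- As βδ is the integer n, the bound on y says exactly that the leading digit is below n.
    have hy : y < δ ↔ β * y < n := by
      rw [← hβδ]; exact (mul_lt_mul_iff_right₀ (by linarith)).symm
    rw [hy]
    constructor
    · rintro ⟨d, hd, h⟩
      have h1 := h.1.2
      have hd' : (d : ℝ) + 1 ≤ n := by exact_mod_cast hd
      exact ⟨Or.inl ⟨d, by omega, h⟩, by linarith⟩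
    · rintro ⟨⟨d, hd, h⟩ | ⟨h, -⟩, hlt⟩
      · refine ⟨d, ?_, h⟩
        have := h.1.1
        have : (d : ℝ) < n := by linarith
        exact_mod_cast this
      · have := h.1.1
        have hn' : (n : ℝ) ≤ M := by exact_mod_cast hn
        linarith
  length_first := h.length_succ_first hM
  length_second := by
    rw [wlen_lpow, h.length_first, pow_succ]
    linear_combination -(β ^ k) * hβδ

/-- The digits of `1` in base `β` are `M, q, q, q, ⋯`. -/
theorem succ_of_periodic (hβ : 1 < β) (hM : β = M + δ) (hδ : 0 < δ) (hδ' : δ < 1) {q : ℕ}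
    (hq : q < M) (hβδ : β * δ = q + δ) (h : PosCoding β δ k W V) :
    PosCoding β δ (k + 1) (lpow W M ++ V) (lpow W q ++ V) where
  first := h.succ_first hβ hM hδ hδ'
  second x := by
    rw [mem_zeroSet_pos_succ hβ hM hδ.le hδ', h.exists_occ_lpow_append]
    simp only [← div_pow_succ hβ]
    generalize x / β ^ (k + 1) = y
    have hy : y < δ ↔ β * y < q + δ := by
      rw [← hβδ]; exact (mul_lt_mul_iff_right₀ (by linarith)).symm
    rw [hy]
    have hq' : (q : ℝ) + 1 ≤ M := by exact_mod_cast hq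
    constructor
    · rintro (⟨d, hd, h⟩ | ⟨h, hlt⟩)
      · have h1 := h.1.2
        have hd' : (d : ℝ) + 1 ≤ q := by exact_mod_cast hd
        exact ⟨Or.inl ⟨d, by omega, h⟩, by linarith⟩
      · exact ⟨Or.inl ⟨q, hq, h⟩, by linarith⟩
    · rintro ⟨⟨d, hd, h⟩ | ⟨h, -⟩, hlt⟩
      · have h0 := h.1.1
        rcases lt_trichotomy d q with hdq | rfl | hdq
        · exact Or.inl ⟨d, hdq, h⟩
        · exact Or.inr ⟨h, by linarith⟩
        · have hd' : (q : ℝ) + 1 ≤ d := by exact_mod_cast hdq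
          linarith
      · have := h.1.1
        linarith
  length_first := h.length_succ_first hM
  length_second := by
    rw [wlen_append, wlen_lpow, h.length_first, h.length_second, pow_succ]
    linear_combination -(β ^ k) * hβδ

end PosCoding

theorem posTiling_of_coding (hβ : 1 < β) (hM : 2 ≤ M) {W V : ℕ → List (Fin 2)}
    (h : ∀ k, PosCoding β δ k (W k) (V k)) (hW : ∀ k, W (k + 1) = lpow (W k) M ++ V k) :
    PosTiling (posIntegers β) ![1, δ] W where
  ne_nil k hk := by
    have h1 := (h k).length_first
    rw [hk, wlen_nil] at h1
    exact (pow_pos (by linarith : 0 < β) k).ne h1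
  extend k := by
    -- M ≥ 2 leaves at least one further copy of W k, so the extension is nonempty.
    obtain ⟨N, rfl⟩ := Nat.exists_eq_add_of_le' hM
    refine ⟨lpow (W k) (N + 1) ++ V k, fun h0 => ?_, ?_⟩
    · rw [lpow_succ] at h0
      have h1 := (h k).length_first
      simp only [List.append_eq_nil_iff] at h0
      rw [h0.1.1, wlen_nil] at h1
      exact (pow_pos (by linarith : 0 < β) k).ne h1
    · rw [hW, lpow_succ, List.append_assoc]
  mem_iff x := by
    rw [posIntegers_iff hβ]
    exact exists_congr fun k => ((h k).first x).symm

end PositiveWords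

end BetaInt
namespace BetaInt

/-! ### The words of the negative base -/

section NegativeSets

variable {β δ : ℝ} {M k : ℕ}

/-- By `hfix`, y < l+δ means -βy > l+δ+r. Hence the digit r requires the upper part of its cell, the
digits strictly between r and M a full cell, and the digit M its usual lower part. -/
theorem mem_lower_of_fixed (hβ : 1 < β) (hM : β = M + δ) (hδ : 0 < δ) (hδ' : δ < 1) {r p : ℕ}
    (hrp : M = r + 1 + p) (hfix : -β * (negLeft β + δ) = negLeft β + δ + r)
    (hk : negLeft β ∉ zeroSet (-β) (negLeft β) k ∧
      negLeft β + δ ∉ zeroSet (-β) (negLeft β) k) {y : ℝ} :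
    (y ∈ zeroSet (-β) (negLeft β) (k + 1) ∧ y < negLeft β + δ) ↔
      ((-β * y - M ∈ zeroSet (-β) (negLeft β) k ∧ -β * y - M < negLeft β + δ) ∨
      (∃ d : ℕ, r + 1 ≤ d ∧ d < r + 1 + p ∧ -β * y - d ∈ zeroSet (-β) (negLeft β) k)) ∨
      (-β * y - r ∈ zeroSet (-β) (negLeft β) k ∧ negLeft β + δ ≤ -β * y - r) := by
  have hy : y < negLeft β + δ ↔ negLeft β + δ + r < -β * y := by
    constructor <;> intro h <;> nlinarith
  have hM' : (M : ℝ) = r + 1 + p := by rw [hrp]; push_cast; ring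
  have hp : (0 : ℝ) ≤ p := Nat.cast_nonneg p
  rw [mem_zeroSet_neg_succ hβ hM hδ hδ' hk, hy]
  constructor
  · rintro ⟨⟨d, hd, h⟩ | h, hlt⟩
    · rcases lt_trichotomy d r with hdr | rfl | hdr
      · have h1 := h.1.2
        have hd' : (d : ℝ) + 1 ≤ r := by exact_mod_cast hdr
        linarith
      · exact Or.inr ⟨h, by linarith⟩
      · exact Or.inl (Or.inr ⟨d, by omega, by omega, h⟩)
    · exact Or.inl (Or.inl h)
  · rintro ((h | ⟨d, hd, hd2, h⟩) | ⟨h, hle⟩)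
    · exact ⟨Or.inr h, by linarith [h.1.1.1]⟩
    · have hd' : (r : ℝ) + 1 ≤ d := by exact_mod_cast hd
      exact ⟨Or.inl ⟨d, by omega, h⟩, by linarith [h.1.1]⟩
    · have hne : negLeft β + δ ≠ -β * y - r := fun h' => hk.2 (h' ▸ h)
      have := lt_of_le_of_ne hle hne
      exact ⟨Or.inl ⟨r, by omega, h⟩, by linarith⟩

theorem mem_upper_of_fixed (hβ : 1 < β) (hM : β = M + δ) (hδ : 0 < δ) (hδ' : δ < 1) {r p : ℕ}
    (hrp : M = r + 1 + p) (hfix : -β * (negLeft β + δ) = negLeft β + δ + r)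
    (hk : negLeft β ∉ zeroSet (-β) (negLeft β) k ∧
      negLeft β + δ ∉ zeroSet (-β) (negLeft β) k) {y : ℝ} :
    (y ∈ zeroSet (-β) (negLeft β) (k + 1) ∧ negLeft β + δ ≤ y) ↔
      (∃ d : ℕ, 0 ≤ d ∧ d < 0 + r ∧ -β * y - d ∈ zeroSet (-β) (negLeft β) k) ∨
      (-β * y - r ∈ zeroSet (-β) (negLeft β) k ∧ -β * y - r < negLeft β + δ) := by
  have hy : negLeft β + δ ≤ y ↔ -β * y ≤ negLeft β + δ + r := by
    constructor <;> intro h <;> nlinarith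
  have hM' : (M : ℝ) = r + 1 + p := by rw [hrp]; push_cast; ring
  have hp : (0 : ℝ) ≤ p := Nat.cast_nonneg p
  rw [mem_zeroSet_neg_succ hβ hM hδ hδ' hk, hy]
  constructor
  · rintro ⟨⟨d, hd, h⟩ | h, hle⟩
    · rcases lt_trichotomy d r with hdr | rfl | hdr
      · exact Or.inl ⟨d, Nat.zero_le d, by omega, h⟩
      · have hne : -β * y - d ≠ negLeft β + δ := fun h' => hk.2 (h' ▸ h)
        exact Or.inr ⟨h, lt_of_le_of_ne (by linarith) hne⟩
      · have hd' : (r : ℝ) + 1 ≤ d := by exact_mod_cast hdr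
        linarith [h.1.1]
    · linarith [h.1.1.1]
  · rintro (⟨d, -, hd, h⟩ | ⟨h, hlt⟩)
    · have hd' : (d : ℝ) + 1 ≤ r := by
        rw [zero_add] at hd
        exact_mod_cast hd
      exact ⟨Or.inl ⟨d, by omega, h⟩, by linarith [h.1.2]⟩
    · exact ⟨Or.inl ⟨r, by omega, h⟩, by linarith⟩

/-- By `hret`, y < l+δ means -βy > l+n, which cuts exactly between two cells: no part of the form
[l+δ, l+1) is needed here. -/
theorem mem_lower_of_return (hβ : 1 < β) (hM : β = M + δ) (hδ : 0 < δ) (hδ' : δ < 1) {n q : ℕ}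
    (hnq : M = n + q) (hq : 1 ≤ q) (hret : -β * (negLeft β + δ) = negLeft β + n)
    (hk : negLeft β ∉ zeroSet (-β) (negLeft β) k ∧
      negLeft β + δ ∉ zeroSet (-β) (negLeft β) k) {y : ℝ} :
    (y ∈ zeroSet (-β) (negLeft β) (k + 1) ∧ y < negLeft β + δ) ↔
      (∃ d : ℕ, n ≤ d ∧ d < n + q ∧ -β * y - d ∈ zeroSet (-β) (negLeft β) k) ∨
      (-β * y - M ∈ zeroSet (-β) (negLeft β) k ∧ -β * y - M < negLeft β + δ) := by
  have hy : y < negLeft β + δ ↔ negLeft β + n < -β * y := by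
    constructor <;> intro h <;> nlinarith
  have hM' : (M : ℝ) = n + q := by rw [hnq]; push_cast; ring
  have hq' : (1 : ℝ) ≤ q := by exact_mod_cast hq
  rw [mem_zeroSet_neg_succ hβ hM hδ hδ' hk, hy]
  constructor
  · rintro ⟨⟨d, hd, h⟩ | h, hlt⟩
    · rcases lt_or_ge d n with hdn | hdn
      · have hd' : (d : ℝ) + 1 ≤ n := by exact_mod_cast hdn
        linarith [h.1.2]
      · exact Or.inl ⟨d, hdn, by omega, h⟩
    · exact Or.inr h
  · rintro (⟨d, hd, hd2, h⟩ | h)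
    · have hd' : (n : ℝ) ≤ d := by exact_mod_cast hd
      have hne : negLeft β ≠ -β * y - d := fun h' => hk.1 (h' ▸ h)
      have := lt_of_le_of_ne h.1.1 hne
      exact ⟨Or.inl ⟨d, by omega, h⟩, by linarith⟩
    · exact ⟨Or.inr h, by linarith [h.1.1.1]⟩

end NegativeSets

section NegativeWords

variable {β δ : ℝ} {M k : ℕ} {a c e : List (Fin 2)} {s q r : ℝ}

/-- The words `a` and `c`, placed at `s` and `q`, code the points `x` with
`x / (-β)^k` in `[l, l + 1)` and in `[l, l + δ)`. -/
structure NegCoding (β δ : ℝ) (k : ℕ) (a c : List (Fin 2)) (s q : ℝ) : Prop where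
  first : ∀ x, Occ ![1, δ] s a x 0 ↔ x / (-β) ^ k ∈ zeroSet (-β) (negLeft β) k
  second : ∀ x, Occ ![1, δ] q c x 0 ↔
    x / (-β) ^ k ∈ zeroSet (-β) (negLeft β) k ∧ x / (-β) ^ k < negLeft β + δ
  length_first : wlen ![1, δ] a = β ^ k
  length_second : wlen ![1, δ] c = δ * β ^ k

/-- The word `e`, placed at `r`, codes the points `x` with `x / (-β)^k` in `[l + δ, l + 1)`. -/
structure NegRest (β δ : ℝ) (k : ℕ) (e : List (Fin 2)) (r : ℝ) : Prop where
  mem_iff : ∀ x, Occ ![1, δ] r e x 0 ↔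
    x / (-β) ^ k ∈ zeroSet (-β) (negLeft β) k ∧ negLeft β + δ ≤ x / (-β) ^ k
  length : wlen ![1, δ] e = (1 - δ) * β ^ k

namespace NegCoding

theorem occ_second (h : NegCoding β δ k a c s q) (d : ℕ) {p : ℝ} (hp : p = q + d * (-β) ^ k)
    (x : ℝ) : Occ ![1, δ] p c x 0 ↔
      (x - d * (-β) ^ k) / (-β) ^ k ∈ zeroSet (-β) (negLeft β) k ∧
        (x - d * (-β) ^ k) / (-β) ^ k < negLeft β + δ := by
  rw [← h.second, occ_sub, hp]

theorem occ_lpow_even (hk : Even k) (h : NegCoding β δ k a c s q) {lo N : ℕ} {p : ℝ}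
    (hp : p = s + lo * β ^ k) (x : ℝ) : Occ ![1, δ] p (lpow a N) x 0 ↔
      ∃ d : ℕ, lo ≤ d ∧ d < lo + N ∧
        (x - d * (-β) ^ k) / (-β) ^ k ∈ zeroSet (-β) (negLeft β) k := by
  rw [occ_lpow_up h.length_first hp]
  simp only [h.first, hk.neg_pow]

theorem occ_lpow_odd (hk : Odd k) (h : NegCoding β δ k a c s q) {lo N : ℕ} {p : ℝ}
    (hp : p = s - (lo + N - 1) * β ^ k) (x : ℝ) : Occ ![1, δ] p (lpow a N) x 0 ↔
      ∃ d : ℕ, lo ≤ d ∧ d < lo + N ∧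
        (x - d * (-β) ^ k) / (-β) ^ k ∈ zeroSet (-β) (negLeft β) k := by
  rw [occ_lpow_down h.length_first hp]
  simp only [h.first, hk.neg_pow]

theorem succ_first_even (hβ : 1 < β) (hM : β = M + δ) (hδ : 0 < δ) (hδ' : δ < 1)
    (hk' : negLeft β ∉ zeroSet (-β) (negLeft β) k ∧
      negLeft β + δ ∉ zeroSet (-β) (negLeft β) k) (hk : Even k)
    (h : NegCoding β δ k a c s s) (x : ℝ) : Occ ![1, δ] s (lpow a M ++ c) x 0 ↔
      x / (-β) ^ (k + 1) ∈ zeroSet (-β) (negLeft β) (k + 1) := by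
  rw [mem_zeroSet_neg_succ hβ hM hδ hδ' hk', occ_append,
    h.occ_lpow_even hk (lo := 0) (by simp),
    h.occ_second M (by rw [wlen_lpow, h.length_first, hk.neg_pow])]
  simp only [div_neg_pow_succ hβ, zero_add, zero_le, true_and]

/-- For odd k the factor (-β)^k is negative: larger digits lie further left, and the part of [l,
l+δ) is at the right end of a. The incomplete block c of digit M therefore comes first. -/
theorem succ_first_odd (hβ : 1 < β) (hM : β = M + δ) (hδ : 0 < δ) (hδ' : δ < 1)
    (hk' : negLeft β ∉ zeroSet (-β) (negLeft β) k ∧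
      negLeft β + δ ∉ zeroSet (-β) (negLeft β) k) (hk : Odd k)
    (h : NegCoding β δ k a c s (s + (1 - δ) * β ^ k)) (x : ℝ) :
    Occ ![1, δ] (s + (1 - δ) * β ^ k - M * β ^ k) (c ++ lpow a M) x 0 ↔
      x / (-β) ^ (k + 1) ∈ zeroSet (-β) (negLeft β) (k + 1) := by
  rw [mem_zeroSet_neg_succ hβ hM hδ hδ' hk', occ_append,
    h.occ_lpow_odd hk (lo := 0) (by rw [h.length_second]; push_cast; ring),
    h.occ_second M (by rw [hk.neg_pow]; ring), or_comm]
  simp only [div_neg_pow_succ hβ, zero_add, zero_le, true_and]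

theorem length_succ (hM : β = M + δ) (h : NegCoding β δ k a c s q) :
    wlen ![1, δ] (lpow a M ++ c) = β ^ (k + 1) ∧
      wlen ![1, δ] (c ++ lpow a M) = β ^ (k + 1) := by
  simp only [wlen_append, wlen_lpow, h.length_first, h.length_second, pow_succ]
  constructor <;> linear_combination -(β ^ k) * hM

end NegCoding

theorem NegRest.occ (h : NegRest β δ k e r) (d : ℕ) {p : ℝ} (hp : p = r + d * (-β) ^ k)
    (x : ℝ) : Occ ![1, δ] p e x 0 ↔
      (x - d * (-β) ^ k) / (-β) ^ k ∈ zeroSet (-β) (negLeft β) k ∧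
        negLeft β + δ ≤ (x - d * (-β) ^ k) / (-β) ^ k := by
  rw [← h.mem_iff, occ_sub, hp]

/-! #### The point `l + δ` is fixed -/

theorem negCoding_fixed_even (hβ : 1 < β) (hM : β = M + δ) (hδ : 0 < δ) (hδ' : δ < 1) {ρ p : ℕ}
    (hrp : M = ρ + 1 + p) (hfix : -β * (negLeft β + δ) = negLeft β + δ + ρ)
    (hβδ : β * δ = p + 1)
    (hk' : negLeft β ∉ zeroSet (-β) (negLeft β) k ∧
      negLeft β + δ ∉ zeroSet (-β) (negLeft β) k) (hk : Even k)
    (h : NegCoding β δ k a c s s) (he : NegRest β δ k e (s + δ * β ^ k)) :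
    NegCoding β δ (k + 1) (lpow a M ++ c) (e ++ lpow a p ++ c) s
      (s + (1 - δ) * β ^ (k + 1)) ∧ NegRest β δ (k + 1) (lpow a ρ ++ c) s := by
  have hM' : (M : ℝ) = ρ + 1 + p := by rw [hrp]; push_cast; ring
  have hq : s + (1 - δ) * β ^ (k + 1) = s + δ * β ^ k + ρ * β ^ k := by
    rw [pow_succ]
    linear_combination (β ^ k) * hM + (β ^ k) * hM' - (β ^ k) * hβδ
  refine ⟨⟨h.succ_first_even hβ hM hδ hδ' hk' hk, fun x => ?_, (h.length_succ hM).1, ?_⟩,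
    ⟨fun x => ?_, ?_⟩⟩
  · rw [mem_lower_of_fixed hβ hM hδ hδ' hrp hfix hk', hq, occ_append, occ_append,
      he.occ ρ (by rw [hk.neg_pow]),
      h.occ_lpow_even hk (lo := ρ + 1) (by rw [he.length]; push_cast; ring),
      h.occ_second M (by
        rw [wlen_append, wlen_lpow, h.length_first, he.length, hk.neg_pow]
        linear_combination -(β ^ k) * hM')]
    simp only [div_neg_pow_succ hβ]
    have hswap : ∀ {P Q R : Prop}, (P ∨ Q) ∨ R → (R ∨ Q) ∨ P := by tauto
    exact ⟨hswap, hswap⟩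
  · rw [wlen_append, wlen_append, wlen_lpow, h.length_first, h.length_second, he.length, pow_succ]
    linear_combination -(β ^ k) * hβδ
  · rw [mem_upper_of_fixed hβ hM hδ hδ' hrp hfix hk', occ_append,
      h.occ_lpow_even hk (lo := 0) (by simp),
      h.occ_second ρ (by rw [wlen_lpow, h.length_first, hk.neg_pow])]
    simp only [div_neg_pow_succ hβ]
  · rw [wlen_append, wlen_lpow, h.length_first, h.length_second, pow_succ]
    linear_combination (β ^ k) * hβδ - (β ^ k) * hM - (β ^ k) * hM'

theorem negCoding_fixed_odd (hβ : 1 < β) (hM : β = M + δ) (hδ : 0 < δ) (hδ' : δ < 1) {ρ p : ℕ}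
    (hrp : M = ρ + 1 + p) (hfix : -β * (negLeft β + δ) = negLeft β + δ + ρ)
    (hβδ : β * δ = p + 1)
    (hk' : negLeft β ∉ zeroSet (-β) (negLeft β) k ∧
      negLeft β + δ ∉ zeroSet (-β) (negLeft β) k) (hk : Odd k)
    (h : NegCoding β δ k a c s (s + (1 - δ) * β ^ k)) (he : NegRest β δ k e s) {s' : ℝ}
    (hs' : s' = s + (1 - δ) * β ^ k - M * β ^ k) :
    NegCoding β δ (k + 1) (c ++ lpow a M) (c ++ lpow a p ++ e) s' s' ∧
      NegRest β δ (k + 1) (c ++ lpow a ρ) (s' + δ * β ^ (k + 1)) := by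
  have hM' : (M : ℝ) = ρ + 1 + p := by rw [hrp]; push_cast; ring
  have hr : s' + δ * β ^ (k + 1) = s + (1 - δ) * β ^ k - ρ * β ^ k := by
    rw [hs', pow_succ]
    linear_combination (β ^ k) * hβδ - (β ^ k) * hM'
  refine ⟨⟨fun x => ?_, fun x => ?_, (h.length_succ hM).2, ?_⟩, ⟨fun x => ?_, ?_⟩⟩
  · rw [hs']
    exact h.succ_first_odd hβ hM hδ hδ' hk' hk x
  · rw [mem_lower_of_fixed hβ hM hδ hδ' hrp hfix hk', occ_append, occ_append,
      h.occ_second M (by rw [hs', hk.neg_pow]; ring),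
      h.occ_lpow_odd hk (lo := ρ + 1) (by
        rw [h.length_second, hs']
        push_cast
        linear_combination -(β ^ k) * hM'),
      he.occ ρ (by
        rw [wlen_append, wlen_lpow, h.length_first, h.length_second, hk.neg_pow, hs']
        linear_combination -(β ^ k) * hM')]
    simp only [div_neg_pow_succ hβ]
  · rw [wlen_append, wlen_append, wlen_lpow, h.length_first, h.length_second, he.length, pow_succ]
    linear_combination -(β ^ k) * hβδ
  · rw [mem_upper_of_fixed hβ hM hδ hδ' hrp hfix hk', hr, occ_append,
      h.occ_second ρ (by rw [hk.neg_pow]; ring),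
      h.occ_lpow_odd hk (lo := 0) (by rw [h.length_second]; push_cast; ring), or_comm]
    simp only [div_neg_pow_succ hβ]
  · rw [wlen_append, wlen_lpow, h.length_first, h.length_second, pow_succ]
    linear_combination (β ^ k) * hβδ - (β ^ k) * hM - (β ^ k) * hM'

/-! #### The point `l + δ` is sent to `l` -/

theorem negCoding_return_even (hβ : 1 < β) (hM : β = M + δ) (hδ : 0 < δ) (hδ' : δ < 1) {n ν : ℕ}
    (hnq : M = n + ν) (hν : 1 ≤ ν) (hret : -β * (negLeft β + δ) = negLeft β + n)
    (hβδ : β * δ = ν + δ)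
    (hk' : negLeft β ∉ zeroSet (-β) (negLeft β) k ∧
      negLeft β + δ ∉ zeroSet (-β) (negLeft β) k) (hk : Even k)
    (h : NegCoding β δ k a c s s) :
    NegCoding β δ (k + 1) (lpow a M ++ c) (lpow a ν ++ c) s (s + (1 - δ) * β ^ (k + 1)) := by
  have hM' : (M : ℝ) = n + ν := by rw [hnq]; push_cast; ring
  have hq : s + (1 - δ) * β ^ (k + 1) = s + n * β ^ k := by
    rw [pow_succ]
    linear_combination (β ^ k) * hM + (β ^ k) * hM' - (β ^ k) * hβδ
  refine ⟨h.succ_first_even hβ hM hδ hδ' hk' hk, fun x => ?_, (h.length_succ hM).1, ?_⟩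
  · rw [mem_lower_of_return hβ hM hδ hδ' hnq hν hret hk', hq, occ_append,
      h.occ_lpow_even hk (lo := n) rfl,
      h.occ_second M (by
        rw [wlen_lpow, h.length_first, hk.neg_pow]
        linear_combination -(β ^ k) * hM')]
    simp only [div_neg_pow_succ hβ]
  · rw [wlen_append, wlen_lpow, h.length_first, h.length_second, pow_succ]
    linear_combination -(β ^ k) * hβδ

theorem negCoding_return_odd (hβ : 1 < β) (hM : β = M + δ) (hδ : 0 < δ) (hδ' : δ < 1) {n ν : ℕ}
    (hnq : M = n + ν) (hν : 1 ≤ ν) (hret : -β * (negLeft β + δ) = negLeft β + n)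
    (hβδ : β * δ = ν + δ)
    (hk' : negLeft β ∉ zeroSet (-β) (negLeft β) k ∧
      negLeft β + δ ∉ zeroSet (-β) (negLeft β) k) (hk : Odd k)
    (h : NegCoding β δ k a c s (s + (1 - δ) * β ^ k)) {s' : ℝ}
    (hs' : s' = s + (1 - δ) * β ^ k - M * β ^ k) :
    NegCoding β δ (k + 1) (c ++ lpow a M) (c ++ lpow a ν) s' s' := by
  have hM' : (M : ℝ) = n + ν := by rw [hnq]; push_cast; ring
  refine ⟨fun x => ?_, fun x => ?_, (h.length_succ hM).2, ?_⟩
  · rw [hs']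
    exact h.succ_first_odd hβ hM hδ hδ' hk' hk x
  · rw [mem_lower_of_return hβ hM hδ hδ' hnq hν hret hk', occ_append,
      h.occ_second M (by rw [hs', hk.neg_pow]; ring),
      h.occ_lpow_odd hk (lo := n) (by
        rw [h.length_second, hs']
        linear_combination -(β ^ k) * hM'), or_comm]
    simp only [div_neg_pow_succ hβ]
  · rw [wlen_append, wlen_lpow, h.length_first, h.length_second, pow_succ]
    linear_combination -(β ^ k) * hβδ

/-! #### The tiling of the line -/

theorem mem_zeroSet_neg_mono (hβ : 1 < β) (hM : β = M + δ) (hδ : 0 < δ) (hδ' : δ < 1)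
    (hk' : ∀ k, negLeft β ∉ zeroSet (-β) (negLeft β) k ∧
      negLeft β + δ ∉ zeroSet (-β) (negLeft β) k) (hM1 : 1 ≤ M) {i j : ℕ} (hij : i ≤ j) {x : ℝ}
    (h : x / (-β) ^ i ∈ zeroSet (-β) (negLeft β) i) :
    x / (-β) ^ j ∈ zeroSet (-β) (negLeft β) j := by
  induction j, hij using Nat.le_induction with
  | base => exact h
  | succ j _ ih =>
    rw [mem_zeroSet_neg_succ hβ hM hδ hδ' (hk' j)]
    refine Or.inl ⟨0, by omega, ?_⟩
    rw [div_neg_pow_succ hβ]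
    simpa using ih

/-- One parity of levels suffices, since leading zeros make the coded sets increase with the level;
the offset o selects it. Dropping leading zeros, by `mem_zeroSet_of_le`, shows that each level
contains all integers between two of its points. -/
theorem negTiling_of_coding (hβ : 1 < β) (hM : β = M + δ) (hδ : 0 < δ) (hδ' : δ < 1)
    (hk' : ∀ k, negLeft β ∉ zeroSet (-β) (negLeft β) k ∧
      negLeft β + δ ∉ zeroSet (-β) (negLeft β) k) (hM2 : 2 ≤ M) (o : ℕ)
    {a : ℕ → List (Fin 2)} {s : ℕ → ℝ}
    (h : ∀ j x, Occ ![1, δ] (s j) (a j) x 0 ↔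
      x / (-β) ^ (2 * j + o) ∈ zeroSet (-β) (negLeft β) (2 * j + o))
    (hiso : ∀ k, ¬ [1, 1] <:+: a k)
    (hsand : ∀ k, ∃ K X Y, a K = X ++ a k ++ Y ∧ 0 ∈ X ∧ 0 ∈ Y) :
    NegTiling (negBetaIntegers β) δ a s := by
  have hS : ∀ x, x ∈ negBetaIntegers β ↔
      ∃ k : ℕ, x / (-β) ^ k ∈ zeroSet (-β) (negLeft β) k :=
    fun x => negBetaIntegers_iff hβ fun k => (hk' k).1
  have hmono : ∀ {i j : ℕ} {x : ℝ}, i ≤ j → x / (-β) ^ i ∈ zeroSet (-β) (negLeft β) i →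
      x / (-β) ^ j ∈ zeroSet (-β) (negLeft β) j := fun hij hx =>
    mem_zeroSet_neg_mono hβ hM hδ hδ' hk' (by omega) hij hx
  -- Prefixing the digit 1, allowed since M ≥ 2, moves x right at even levels and left at odd
  -- levels; this gives unboundedness both ways.
  have hshift : ∀ k x, x / (-β) ^ k ∈ zeroSet (-β) (negLeft β) k →
      x + (-β) ^ k ∈ negBetaIntegers β := by
    intro k x hx
    refine (hS _).mpr ⟨k + 1, ?_⟩
    rw [mem_zeroSet_neg_succ hβ hM hδ hδ' (hk' k)]
    refine Or.inl ⟨1, by omega, ?_⟩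
    rw [div_neg_pow_succ hβ]
    convert hx using 2
    push_cast
    ring
  refine ⟨?_, ?_, ?_, ?_, hiso, ?_, ?_, hsand⟩
  · exact (hS 0).mpr ⟨0, by
      rw [zero_div]
      exact zero_mem_zeroSet (negLeft_neg hβ).le (negLeft_add_one_pos hβ) 0⟩
  · intro k x hx
    rw [h] at hx ⊢
    exact hmono (by omega) hx
  · intro x
    rw [hS]
    constructor
    · rintro ⟨k, hk⟩
      exact ⟨k, (h k x).mpr (hmono (by omega) hk)⟩
    · rintro ⟨k, hk⟩
      exact ⟨_, (h k x).mp hk⟩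
  · intro k x y hx hy z hz hxz hzy
    rw [h] at hx hy ⊢
    obtain ⟨K, hK⟩ := (hS z).mp hz
    rcases le_total K (2 * k + o) with hle | hle
    · exact hmono hle hK
    · refine mem_zeroSet_of_le hβ ?_ hle hK
      have hI : ∀ w, w / (-β) ^ (2 * k + o) ∈ zeroSet (-β) (negLeft β) (2 * k + o) →
          w / (-β) ^ (2 * k + o) ∈ Set.Ioo (negLeft β) (negLeft β + 1) := fun w hw =>
        ⟨lt_of_le_of_ne hw.1.1 fun h' => (hk' _).1 (by rwa [← h'] at hw), hw.1.2⟩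
      have hx' := hI x hx
      have hy' := hI y hy
      -- A negative power exchanges the roles of x and y.
      rcases lt_or_ge 0 ((-β) ^ (2 * k + o)) with hp | hp
      · exact ⟨hx'.1.trans_le (div_le_div_of_nonneg_right hxz hp.le),
          (div_le_div_of_nonneg_right hzy hp.le).trans_lt hy'.2⟩
      · exact ⟨hy'.1.trans_le (div_le_div_of_nonpos_of_le hp hzy),
          (div_le_div_of_nonpos_of_le hp hxz).trans_lt hx'.2⟩
  · intro x hx
    obtain ⟨k, hk⟩ := (hS x).mp hx
    refine ⟨_, hshift (2 * k) x (hmono (by omega) hk), ?_⟩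
    have : 0 < (-β) ^ (2 * k) := (even_two_mul k).pow_pos (by linarith)
    linarith
  · intro x hx
    obtain ⟨k, hk⟩ := (hS x).mp hx
    refine ⟨_, hshift (2 * k + 1) x (hmono (by omega) hk), ?_⟩
    have : (-β) ^ (2 * k + 1) < 0 := (odd_two_mul_add_one k).pow_neg (by linarith)
    linarith

end NegativeWords

end BetaInt
namespace BetaInt

/-! ### Combinatorics of the recursions -/

section Combinatorics

variable {a c e W V y z : List (Fin 2)} {M N : ℕ}

theorem not_infix_flatMap_mor (w : List (Fin 2)) : ¬ [1, 1] <:+: w.flatMap mor := by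
  induction w with
  | nil => simp
  | cons b w ih =>
    match b with
    | 0 =>
      intro h
      have h' : [1, 1] <:+: (0 : Fin 2) :: w.flatMap mor := h
      rw [List.infix_cons_iff] at h'
      rcases h' with h' | h'
      · simp at h'
      · exact ih h'
    | 1 =>
      intro h
      have h' : [1, 1] <:+: (1 : Fin 2) :: 0 :: w.flatMap mor := h
      rw [List.infix_cons_iff, List.infix_cons_iff] at h'
      rcases h' with h' | h' | h'
      · simp at h'
      · simp at h'
      · exact ih h'

theorem not_infix_flatMap_morTilde (w : List (Fin 2)) : ¬ [1, 1] <:+: w.flatMap morTilde := by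
  intro h
  have h1 : [1, 1] <:+: 0 :: w.flatMap mor := by
    rw [← flatMap_morTilde_append]
    exact h.trans (List.prefix_append _ _).isInfix
  rw [List.infix_cons_iff] at h1
  rcases h1 with h1 | h1
  · simp at h1
  · exact not_infix_flatMap_mor w h1

/-- The word `w` is the image of a word under the morphism `σ`. -/
def IsImage (σ : Fin 2 → List (Fin 2)) (w : List (Fin 2)) : Prop := ∃ x : List (Fin 2), w = x.flatMap σ

theorem IsImage.append {σ : Fin 2 → List (Fin 2)} {w w' : List (Fin 2)} (h : IsImage σ w)
    (h' : IsImage σ w') : IsImage σ (w ++ w') := by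
  obtain ⟨x, rfl⟩ := h
  obtain ⟨x', rfl⟩ := h'
  exact ⟨x ++ x', by rw [List.flatMap_append]⟩

theorem IsImage.lpow {σ : Fin 2 → List (Fin 2)} {w : List (Fin 2)} (h : IsImage σ w) (N : ℕ) :
    IsImage σ (lpow w N) := by
  induction N with
  | zero => exact ⟨[], rfl⟩
  | succ N ih => rw [lpow_succ]; exact h.append ih

theorem conj_lpow_append (hW : W ++ z = z ++ a) (hV : V ++ z = z ++ c) (N : ℕ) :
    (lpow W N ++ V) ++ z = z ++ (lpow a N ++ c) := by
  rw [List.append_assoc, hV, ← List.append_assoc, lpow_conj hW, List.append_assoc]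

/-- The common conjugation of the words of both recursions, when `l + δ` is fixed: from odd to
even levels. -/
theorem conj_fixed_odd {ρ p : ℕ} (hM : M = ρ + 1 + p) (ha : a = e ++ c)
    (hW : W ++ (y ++ c) = (y ++ c) ++ a) (hV : V ++ (y ++ c) = (y ++ c) ++ c) :
    (lpow W M ++ V) ++ y = y ++ (c ++ lpow a M) ∧
      lpow W (p + 1) ++ y = y ++ (c ++ lpow a p ++ e) ∧
      c ++ lpow a M = (c ++ lpow a p ++ e) ++ (c ++ lpow a ρ) := by
  refine ⟨?_, ?_, ?_⟩
  · apply List.append_cancel_right (bs := c)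
    rw [List.append_assoc, conj_lpow_append hW hV]
    simp
  -- The hypotheses conjugate by yc. Restoring the trailing c makes them applicable.
  · apply List.append_cancel_right (bs := c)
    rw [List.append_assoc, lpow_conj hW, lpow_succ']
    conv_lhs => rw [ha]
    simp [← ha]
  · have hMp : M = p + (1 + ρ) := by omega
    have h5 : a ++ lpow a ρ = e ++ (c ++ lpow a ρ) := by rw [← List.append_assoc e, ← ha]
    rw [hMp, lpow_add, add_comm 1 ρ, lpow_succ, h5]
    simp

/-- The common conjugation of the words of both recursions, when `l + δ` is fixed: from even to
odd levels. -/
theorem conj_fixed_even {ρ p : ℕ} (hM : M = ρ + 1 + p) (ha : a = c ++ e)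
    (hW : W ++ y = y ++ a) (hV : V ++ y = y ++ c) {z : List (Fin 2)}
    (hz : z = y ++ (lpow a ρ ++ c) ++ (e ++ lpow a p ++ c)) :
    (lpow W M ++ V) ++ z = z ++ (lpow a M ++ c) ∧
      lpow W (p + 1) ++ z = z ++ (e ++ lpow a p ++ c) ∧
      lpow a M ++ c = (lpow a ρ ++ c) ++ (e ++ lpow a p ++ c) := by
  have h3 : lpow a M ++ c = (lpow a ρ ++ c) ++ (e ++ lpow a p ++ c) := by
    rw [hM, lpow_add, lpow_succ']
    simp [ha]
  have hz' : z = y ++ (lpow a M ++ c) := by rw [hz, h3, List.append_assoc]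
  refine ⟨?_, ?_, h3⟩
  · rw [hz', ← List.append_assoc, conj_lpow_append hW hV]
  · rw [hz', ← List.append_assoc, lpow_conj hW, lpow_succ']
    -- Joining c and e to a gives a^M c·e a^p c = a^{M+1+p} c, from which p + 1 copies of a can be
    -- split off on the left.
    have h4 : lpow a M ++ c ++ (e ++ lpow a p ++ c) = lpow a p ++ a ++ (lpow a M ++ c) := by
      rw [← lpow_succ', ← List.append_assoc (lpow a (p + 1)), ← lpow_add, add_comm, lpow_add,
        lpow_succ]
      have h5 : a ++ (lpow a p ++ c) = c ++ (e ++ (lpow a p ++ c)) := by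
        rw [← List.append_assoc c, ← ha]
      simp [h5]
    rw [List.append_assoc y, List.append_assoc y, h4]

/-- The common conjugation of the words of both recursions, when `l + δ` is sent to `l`. -/
theorem conj_return (hW : z ++ W = a ++ z) (hV : z ++ V = c ++ z) (N : ℕ) :
    (c ++ z) ++ (lpow W N ++ V) = (c ++ lpow a N) ++ (c ++ z) := by
  have h1 := lpow_conj hW.symm N
  rw [List.append_assoc, ← List.append_assoc z, ← h1, List.append_assoc, hV]
  simp

/-- When c is the last factor in both recursions, the conjugating word passes to the next level
unchanged. -/
theorem conj_append_return (hW : z ++ W = a ++ z) (hV : z ++ V = c ++ z) (N : ℕ) :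
    z ++ (lpow W N ++ V) = (lpow a N ++ c) ++ z := by
  have h1 := lpow_conj hW.symm N
  rw [← List.append_assoc, ← h1, List.append_assoc, hV, List.append_assoc]

theorem lpow_two_infix (w x : List (Fin 2)) (hM : 2 ≤ M) : w ++ w <:+: lpow w M ++ x := by
  obtain ⟨N, rfl⟩ := Nat.exists_eq_add_of_le' hM
  exact ⟨[], lpow w N ++ x, by rw [lpow_succ, lpow_succ]; simp⟩

/-- Take the second a of the first block: ca precedes it, and the whole second block, which again
contains a, follows it. -/
theorem sandwich_step (hM : 2 ≤ M) (ha : 0 ∈ a) (x : List (Fin 2)) :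
    ∃ X Y, lpow (c ++ lpow a M) M ++ x = X ++ a ++ Y ∧ (0 : Fin 2) ∈ X ∧ (0 : Fin 2) ∈ Y := by
  obtain ⟨N, rfl⟩ := Nat.exists_eq_add_of_le' hM
  refine ⟨c ++ a, lpow a N ++ (c ++ lpow a (N + 2)) ++ lpow (c ++ lpow a (N + 2)) N ++ x, ?_, ?_,
    ?_⟩
  · rw [lpow_succ (c ++ lpow a (N + 2)) (N + 1), lpow_succ (c ++ lpow a (N + 2)) N]
    have h1 : lpow a (N + 2) = a ++ (a ++ lpow a N) := by rw [lpow_succ, lpow_succ]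
    generalize lpow a (N + 2) = b at h1 ⊢
    generalize lpow (c ++ b) N = b'
    subst h1
    simp
  · simp [ha]
  · rw [lpow_succ a]
    simp [ha]

theorem append_self_infix_step (hM : 2 ≤ M) (x : List (Fin 2)) :
    a ++ a <:+: lpow (c ++ lpow a M) M ++ x := by
  have h1 : a ++ a <:+: c ++ lpow a M :=
    (by simpa using lpow_two_infix a [] hM : a ++ a <:+: lpow a M).trans
      (List.suffix_append _ _).isInfix
  exact (h1.trans (List.prefix_append _ _).isInfix).trans (lpow_two_infix (c ++ lpow a M) x hM)

theorem zero_mem_of_recursion (hM : 2 ≤ M) {a : ℕ → List (Fin 2)} (h0 : 0 ∈ a 0)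
    (ha : ∀ j, ∃ c x, a (j + 1) = lpow (c ++ lpow (a j) M) M ++ x) (j : ℕ) : 0 ∈ a j := by
  induction j with
  | zero => exact h0
  | succ j ih =>
    obtain ⟨c, x, h⟩ := ha j
    rw [h]
    exact (append_self_infix_step hM x).subset (by simp [ih])

/-- The language of the coding of the non-negative integers in the positive base agrees with the
language of the tiling for the negative base. -/
theorem language_eq_of_recursion {S S' : Set ℝ} {δ : ℝ} (hδ : 0 < δ) (hδ' : δ < 1) (hM : 2 ≤ M)
    {W V a : ℕ → List (Fin 2)} {s : ℕ → ℝ} (hp : PosTiling S ![1, δ] W)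
    (hn : NegTiling S' δ a s) (hW : ∀ k, W (k + 1) = lpow (W k) M ++ V k)
    (ha : ∀ j, ∃ c x, a (j + 1) = lpow (c ++ lpow (a j) M) M ++ x)
    (haW : ∀ j, a j <:+: W (2 * j + 1) ++ W (2 * j + 1))
    (hWa : ∀ j, W (2 * j + 1) <:+: a j ++ a j) {u : ℕ → Fin 2} {v : ℤ → Fin 2}
    (hu : CodesRight {x | x ∈ S ∨ -x ∈ S} ![1, δ] u) (hv : Codes S' ![1, 1 + δ] v) :
    language u = languageZ (imageZ morTilde morTilde_ne_nil v) := by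
  ext w
  rw [hp.mem_language_iff (pair_pos hδ) (pair_injective hδ'.ne) hu,
    hn.mem_languageZ_iff hδ hδ' hv]
  constructor
  · rintro ⟨k, hk⟩
    obtain ⟨c, x, h⟩ := ha k
    -- The level k is raised to 2k + 1, where the conjugate negative word is a k.
    refine ⟨k + 1, ((hk.trans (hp.prefix_of_le (by omega)).isInfix).trans (hWa k)).trans ?_⟩
    rw [h]
    exact append_self_infix_step hM x
  · rintro ⟨k, hk⟩
    refine ⟨2 * k + 1 + 1, (hk.trans (haW k)).trans ?_⟩
    rw [hW (2 * k + 1)]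
    exact lpow_two_infix _ _ hM

end Combinatorics

/-- The words of the level `0` of the negative base. -/
theorem negCoding_zero {β δ : ℝ} (hβ : 1 < β) (hneg : negLeft β + δ < 0) :
    NegCoding β δ 0 [0] [1] 0 0 where
  first x := by
    rw [pow_zero, div_one, mem_zeroSet_zero (negLeft_neg hβ).le (negLeft_add_one_pos hβ)]
    simp [Occ]
  second x := by
    rw [pow_zero, div_one, mem_zeroSet_zero (negLeft_neg hβ).le (negLeft_add_one_pos hβ)]
    simp only [Occ, or_false]
    constructor
    · rintro ⟨-, h⟩; exact absurd h (by decide)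
    -- As l+δ < 0, the point 0 is not in [l, l+δ), so that part of level 0 is pure filler.
    · rintro ⟨rfl, h⟩; linarith
  length_first := by simp
  length_second := by simp

/-! ### The roots of `x² - m x - n` -/

section Fixed

/-- The words `W` and `V` of the positive base when the digits of `1` are `M, p + 1`. -/
def finiteWords (M p : ℕ) : ℕ → List (Fin 2) × List (Fin 2)
  | 0 => ([0], [1])
  | k + 1 => (lpow (finiteWords M p k).1 M ++ (finiteWords M p k).2,
      lpow (finiteWords M p k).1 (p + 1))

/-- The words and the position of a level of the negative base. -/
structure NegLevel where
  (a c e : List (Fin 2))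
  s : ℝ

/-- The words of the negative base at the level `2 j + 1` when `l + δ` is fixed. -/
noncomputable def fixedLevel (β δ : ℝ) (M ρ p : ℕ) : ℕ → NegLevel
  | 0 => ⟨1 :: lpow [0] M, lpow [0] (p + 1), 1 :: lpow [0] ρ, -δ⟩
  | j + 1 =>
    let L := fixedLevel β δ M ρ p j
    let a := L.c ++ lpow L.a M
    let c := L.c ++ lpow L.a p ++ L.e
    let e := L.c ++ lpow L.a ρ
    ⟨lpow a M ++ c, e ++ lpow a p ++ c, lpow a ρ ++ c,
      L.s + (1 - δ) * β ^ (2 * j + 1) - M * β ^ (2 * j + 1)⟩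

variable {β δ : ℝ} {M ρ p : ℕ}

/-- This keeps the letters 1 isolated. The conditions M ≥ 1 and ρ ≥ 1 put a 0 after the initial 1 of
the starting words. -/
theorem fixedLevel_isImage (hM : 1 ≤ M) (hρ : 1 ≤ ρ) (j : ℕ) :
    IsImage mor (fixedLevel β δ M ρ p j).a ∧ IsImage mor (fixedLevel β δ M ρ p j).c ∧
      IsImage mor (fixedLevel β δ M ρ p j).e := by
  have hzero : ∀ N, IsImage mor (lpow [0] N) := fun N => IsImage.lpow ⟨[0], rfl⟩ N
  have hone : ∀ N, 1 ≤ N → IsImage mor (1 :: lpow [0] N) := by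
    intro N hN
    obtain ⟨N, rfl⟩ := Nat.exists_eq_add_of_le' hN
    exact IsImage.append (w := [1, 0]) ⟨[1], rfl⟩ (hzero N)
  induction j with
  | zero => exact ⟨hone M hM, hzero _, hone ρ hρ⟩
  | succ j ih =>
    obtain ⟨ha, hc, he⟩ := ih
    have ha1 := hc.append (ha.lpow M)
    have hc1 := (hc.append (ha.lpow p)).append he
    have he1 := hc.append (ha.lpow ρ)
    exact ⟨(ha1.lpow M).append hc1, (he1.append (ha1.lpow p)).append hc1,
      (ha1.lpow ρ).append hc1⟩

/-- The words of the negative base are conjugate to those of the positive base. If `p = 0`, then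
the conjugating words describe the part of the line to the right of the origin. -/
theorem fixedLevel_conj (hM : M = ρ + 1 + p) (hρ : 1 ≤ ρ)
    (hlen : ∀ j, wlen ![1, δ] (fixedLevel β δ M ρ p j).a = β ^ (2 * j + 1) ∧
      wlen ![1, δ] (fixedLevel β δ M ρ p j).c = δ * β ^ (2 * j + 1)) (j : ℕ) :
    (fixedLevel β δ M ρ p j).a = (fixedLevel β δ M ρ p j).e ++ (fixedLevel β δ M ρ p j).c ∧
    ∃ y, (finiteWords M p (2 * j + 1)).1 ++ (y ++ (fixedLevel β δ M ρ p j).c) =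
        (y ++ (fixedLevel β δ M ρ p j).c) ++ (fixedLevel β δ M ρ p j).a ∧
      (finiteWords M p (2 * j + 1)).2 ++ (y ++ (fixedLevel β δ M ρ p j).c) =
        (y ++ (fixedLevel β δ M ρ p j).c) ++ (fixedLevel β δ M ρ p j).c ∧
      (p = 0 → y <+: (finiteWords M p (2 * j + 1)).1 ∧
        ∃ f, (fixedLevel β δ M ρ p j).a = f ++ 0 :: y ∧
          (fixedLevel β δ M ρ p j).s + wlen ![1, δ] f = 0) := by
  induction j with
  | zero =>
    have hM1 : M = ρ + (1 + p) := by omega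
    have hy : lpow [0] ρ ++ lpow [0] (p + 1) = lpow ([0] : List (Fin 2)) M := by
      rw [← lpow_add, hM1, add_comm p 1]
    refine ⟨?_, lpow [0] ρ, ?_, ?_, ?_⟩
    · change 1 :: lpow [0] M = (1 :: lpow [0] ρ) ++ lpow [0] (p + 1)
      rw [List.cons_append, hy]
    · change (lpow [0] M ++ [1]) ++ (lpow [0] ρ ++ lpow [0] (p + 1)) =
        (lpow [0] ρ ++ lpow [0] (p + 1)) ++ (1 :: lpow [0] M)
      rw [hy]
      simp
    · change lpow [0] (p + 1) ++ (lpow [0] ρ ++ lpow [0] (p + 1)) =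
        (lpow [0] ρ ++ lpow [0] (p + 1)) ++ lpow [0] (p + 1)
      rw [hy, lpow_append_comm]
    · rintro rfl
      refine ⟨?_, [1], ?_, ?_⟩
      · change lpow [0] ρ <+: lpow [0] M ++ [1]
        exact (prefix_lpow _ (by omega)).trans (List.prefix_append _ _)
      · change 1 :: lpow [0] M = _
        rw [hM, add_zero, lpow_succ]
        rfl
      · change -δ + _ = _
        simp
  | succ j ih =>
    obtain ⟨ha, y, hW, hV, hp⟩ := ih
    obtain ⟨h1, h2, h3⟩ := conj_fixed_odd hM ha hW hV
    obtain ⟨h4, h5, h6⟩ := conj_fixed_even hM h3 h1 h2 rfl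
    refine ⟨h6, y ++ (fixedLevel β δ M ρ p (j + 1)).e, h4, h5, ?_⟩
    rintro rfl
    obtain ⟨hpre, f, hf, hs⟩ := hp rfl
    obtain ⟨hla, hlc⟩ := hlen j
    have hMρ : M = ρ + 1 := hM
    have hM' : (M : ℝ) = ρ + 1 := by exact_mod_cast hMρ
    constructor
    -- By conjugation the left side is W'^ρ V' y, where W', V' belong to level 2j+2. Here M = ρ + 1
    -- and V' = W, so it remains to see that Wy is a prefix of W'; it is one of W², as y is a prefix
    -- of W.
    · change y ++ (lpow _ ρ ++ _) <+: lpow (lpow (finiteWords M 0 (2 * j + 1)).1 M ++ _) M ++ _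
      rw [← conj_lpow_append h1 h2]
      refine List.IsPrefix.trans ?_ (List.prefix_append _ _)
      rw [List.append_assoc]
      conv_rhs => rw [hMρ, lpow_succ', ← hMρ]
      refine (List.prefix_append_right_inj _).mpr ?_
      refine List.IsPrefix.trans ?_ (List.prefix_append _ _)
      rw [zero_add, lpow_succ, lpow_zero, List.append_nil]
      refine ((List.prefix_append_right_inj _).mpr hpre).trans ?_
      have h7 : (finiteWords M 0 (2 * j + 1)).1 ++ (finiteWords M 0 (2 * j + 1)).1 =
          lpow (finiteWords M 0 (2 * j + 1)).1 2 := by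
        rw [lpow_succ, lpow_succ, lpow_zero, List.append_nil]
      rw [h7]
      exact prefix_lpow _ (by omega)
    · let L := fixedLevel β δ M ρ 0 j
      -- The new word begins with c a^M, and the origin lies in the last of these M = ρ + 1 copies
      -- of a.
      refine ⟨L.c ++ lpow L.a ρ ++ f, ?_, ?_⟩
      · change lpow (L.c ++ lpow L.a M) M ++ (L.c ++ lpow L.a 0 ++ L.e) =
          _ ++ 0 :: (y ++ (lpow (L.c ++ lpow L.a M) ρ ++ (L.c ++ lpow L.a 0 ++ L.e)))
        have h8 : L.c ++ lpow L.a M = (L.c ++ lpow L.a ρ ++ f) ++ 0 :: y := by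
          rw [hMρ, lpow_succ', List.append_assoc, List.append_assoc]
          exact congrArg (fun w => L.c ++ (lpow L.a ρ ++ w)) hf
        have h9 : lpow (L.c ++ lpow L.a M) M =
            (L.c ++ lpow L.a M) ++ lpow (L.c ++ lpow L.a M) ρ := by
          conv_lhs => rw [hMρ, lpow_succ, ← hMρ]
        rw [h9]
        generalize lpow (L.c ++ lpow L.a M) ρ = b
        rw [h8]
        simp
      · change L.s + (1 - δ) * β ^ (2 * j + 1) - M * β ^ (2 * j + 1) +
          wlen ![1, δ] (L.c ++ lpow L.a ρ ++ f) = 0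
        rw [wlen_append, wlen_append, wlen_lpow, hla, hlc]
        linear_combination hs - β ^ (2 * j + 1) * hM'

/-- The induction cannot start at level 0: there [l+δ, l+1) contains 0, but a word of length 1 - δ
has no letter 0. At level 1 the natural word 0^M 1 is replaced by 1 0^M placed at -δ; the letters 0
stay where they are, and the word now splits as required. -/
theorem fixedLevel_coding (hβ : 1 < β) (hM : β = M + δ) (hδ : 0 < δ) (hδ' : δ < 1)
    (hrp : M = ρ + 1 + p) (hfix : -β * (negLeft β + δ) = negLeft β + δ + ρ)
    (hβδ : β * δ = p + 1) (hneg : negLeft β + δ < 0)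
    (hk' : ∀ k, negLeft β ∉ zeroSet (-β) (negLeft β) k ∧
      negLeft β + δ ∉ zeroSet (-β) (negLeft β) k) (j : ℕ) :
    NegCoding β δ (2 * j + 1) (fixedLevel β δ M ρ p j).a (fixedLevel β δ M ρ p j).c
      (fixedLevel β δ M ρ p j).s ((fixedLevel β δ M ρ p j).s + (1 - δ) * β ^ (2 * j + 1)) ∧
    NegRest β δ (2 * j + 1) (fixedLevel β δ M ρ p j).e (fixedLevel β δ M ρ p j).s := by
  induction j with
  | zero =>
    have h0 := negCoding_zero hβ hneg
    have hM' : (M : ℝ) = ρ + 1 + p := by rw [hrp]; push_cast; ring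
    have hz : ∀ y : ℝ, y ∈ zeroSet (-β) (negLeft β) 0 ↔ y = 0 := fun y =>
      mem_zeroSet_zero (negLeft_neg hβ).le (negLeft_add_one_pos hβ)
    have hocc : ∀ (w : List (Fin 2)) (x : ℝ),
        Occ ![1, δ] (-δ) (1 :: w) x 0 ↔ Occ ![1, δ] 0 w x 0 := by
      intro w x
      simp [Occ]
    refine ⟨⟨fun x => ?_, fun x => ?_, ?_, ?_⟩, ⟨fun x => ?_, ?_⟩⟩
    · have h1 := h0.succ_first_even hβ hM hδ hδ' (hk' 0) (by simp) x
      rw [← h1, occ_append]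
      change Occ ![1, δ] (-δ) (1 :: lpow [0] M) x 0 ↔ _
      rw [hocc]
      simp [Occ]
    · rw [mem_lower_of_fixed hβ hM hδ hδ' hrp hfix (hk' 0)]
      change Occ ![1, δ] (-δ + (1 - δ) * β ^ (2 * 0 + 1)) (lpow [0] (p + 1)) x 0 ↔ _
      rw [h0.occ_lpow_even (by simp) (lo := ρ) (by
        simp only [mul_zero, zero_add, pow_one, pow_zero, mul_one]
        linear_combination hM + hM' - hβδ)]
      simp only [div_neg_pow_succ hβ, mul_zero, hz, pow_zero, mul_one, div_one]
      constructor
      · rintro ⟨d, hd1, hd2, h⟩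
        rcases hd1.eq_or_lt with rfl | hd
        · exact Or.inr ⟨h, by rw [h]; exact hneg.le⟩
        · exact Or.inl (Or.inr ⟨d, hd, by omega, h⟩)
      · rintro ((⟨h, h'⟩ | ⟨d, hd1, hd2, h⟩) | ⟨h, -⟩)
        · rw [h] at h'; linarith
        · exact ⟨d, by omega, by omega, h⟩
        · exact ⟨ρ, le_rfl, by omega, h⟩
    · change wlen ![1, δ] (1 :: lpow [0] M) = _
      rw [wlen_cons, wlen_lpow]
      simp
      linarith
    · change wlen ![1, δ] (lpow [0] (p + 1)) = _
      rw [wlen_lpow]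
      simp
      linarith
    · rw [mem_upper_of_fixed hβ hM hδ hδ' hrp hfix (hk' 0)]
      change Occ ![1, δ] (-δ) (1 :: lpow [0] ρ) x 0 ↔ _
      rw [hocc, h0.occ_lpow_even (by simp) (lo := 0) (by simp)]
      simp only [div_neg_pow_succ hβ, mul_zero, hz, pow_zero, mul_one, div_one]
      constructor
      · exact fun h => Or.inl h
      · rintro (h | ⟨h, h'⟩)
        · exact h
        · rw [h] at h'; linarith
    · change wlen ![1, δ] (1 :: lpow [0] ρ) = _
      rw [wlen_cons, wlen_lpow]
      simp
      linarith
  | succ j ih =>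
    have hodd : Odd (2 * j + 1) := odd_two_mul_add_one j
    have heven : Even (2 * j + 1 + 1) := hodd.add_one
    obtain ⟨h1, h2⟩ := negCoding_fixed_odd hβ hM hδ hδ' hrp hfix hβδ (hk' _) hodd ih.1 ih.2 rfl
    exact negCoding_fixed_even hβ hM hδ hδ' hrp hfix hβδ (hk' _) heven h1 h2

theorem finiteWords_coding (hβ : 1 < β) (hM : β = M + δ) (hδ : 0 < δ) (hδ' : δ < 1)
    (hpM : p + 1 ≤ M) (hβδ : β * δ = p + 1) (k : ℕ) :
    PosCoding β δ k (finiteWords M p k).1 (finiteWords M p k).2 := by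
  induction k with
  | zero => exact posCoding_zero hδ
  | succ k ih => exact ih.succ_of_finite hβ hM hδ hδ' hpM (by push_cast; exact hβδ)

/-- The result for the roots of `x² - M x - (p + 1)`, where `M = ρ + 1 + p`. -/
theorem main_fixed (hβ : 1 < β) (hM : β = M + δ) (hδ : 0 < δ) (hδ' : δ < 1) (hρ : 1 ≤ ρ)
    (hrp : M = ρ + 1 + p) (hβδ : β * δ = p + 1) :
    (∃ u, CodesRight (betaIntegers β) ![1, δ] u) ∧
    (∃ v, Codes (negBetaIntegers β) ![1, 1 + δ] v) ∧
    ∀ u v, CodesRight (betaIntegers β) ![1, δ] u → Codes (negBetaIntegers β) ![1, 1 + δ] v →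
      language u = languageZ (imageZ morTilde morTilde_ne_nil v) ∧
      (p = 0 → u = image mor mor_ne_nil (rightPart v)) := by
  have hM' : (M : ℝ) = ρ + 1 + p := by rw [hrp]; push_cast; ring
  have hρ' : (1 : ℝ) ≤ ρ := by exact_mod_cast hρ
  have hM2 : 2 ≤ M := by omega
  have hl := negLeft_eq hβ
  have hfix : -β * (negLeft β + δ) = negLeft β + δ + ρ := by
    linear_combination hl + hM + hM' - hβδ
  -- Otherwise `hfix` equates a nonpositive number with one that is at least ρ ≥ 1.
  have hneg : negLeft β + δ < 0 := by
    by_contra! h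
    nlinarith
  have hk' := notMem_zeroSet_neg hβ hM hδ.le hδ' hneg.ne (Or.inl (by
    have h1 : -β * (negLeft β + δ) - ((ρ : ℤ) : ℝ) = negLeft β + δ := by
      push_cast; linarith
    rw [T_eq (ρ : ℤ) (by rw [h1]; constructor <;> linarith), h1]))
  have hc := fixedLevel_coding (ρ := ρ) (p := p) hβ hM hδ hδ' hrp hfix hβδ hneg hk'
  have hconj := fixedLevel_conj (β := β) (δ := δ) hrp hρ
    fun j => ⟨(hc j).1.length_first, (hc j).1.length_second⟩
  have hrec : ∀ j, ∃ c x, (fixedLevel β δ M ρ p (j + 1)).a =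
      lpow (c ++ lpow (fixedLevel β δ M ρ p j).a M) M ++ x := fun j => ⟨_, _, rfl⟩
  have hzero : ∀ j, 0 ∈ (fixedLevel β δ M ρ p j).a := by
    refine zero_mem_of_recursion hM2 ?_ hrec
    change (0 : Fin 2) ∈ 1 :: lpow [0] M
    rw [hrp, add_assoc, add_comm, add_assoc, add_comm, lpow_succ']
    simp
  have hpos : PosTiling (posIntegers β) ![1, δ] fun k => (finiteWords M p k).1 :=
    posTiling_of_coding hβ hM2 (finiteWords_coding hβ hM hδ hδ' (by omega) hβδ) fun _ => rfl
  have hn : NegTiling (negBetaIntegers β) δ (fun j => (fixedLevel β δ M ρ p j).a)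
      fun j => (fixedLevel β δ M ρ p j).s := by
    refine negTiling_of_coding hβ hM hδ hδ' hk' hM2 1 (fun j => (hc j).1.first) (fun j => ?_)
      fun j => ?_
    · obtain ⟨w, hw⟩ := (fixedLevel_isImage (β := β) (δ := δ) (p := p) (M := M)
        (by omega) hρ j).1
      rw [hw]
      exact not_infix_flatMap_mor w
    · obtain ⟨c, x, h⟩ := hrec j
      obtain ⟨X, Y, hXY, hX, hY⟩ := sandwich_step (c := c) hM2 (hzero j) x
      exact ⟨j + 1, X, Y, h.trans hXY, hX, hY⟩
  refine ⟨(hpos.hasGaps (pair_pos hδ)).exists_codesRight (pair_pos hδ) hpos.zero_mem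
    (hpos.nonneg (pair_pos hδ)), hn.exists_codes hδ, fun u v hu hv => ⟨?_, ?_⟩⟩
  · refine language_eq_of_recursion hδ hδ' hM2 hpos hn (V := fun k => (finiteWords M p k).2)
      (fun _ => rfl) hrec (fun j => ?_) (fun j => ?_) hu hv
    · obtain ⟨-, y, h, -⟩ := hconj j
      exact (infix_of_conj h).1
    · obtain ⟨-, y, h, -⟩ := hconj j
      exact (infix_of_conj h).2
  · intro hp
    refine hn.eq_image_rightPart hδ hδ' hv fun k => ?_
    obtain ⟨-, y, -, -, h⟩ := hconj k
    obtain ⟨hy, f, hf, hs⟩ := h hp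
    obtain ⟨N, hN⟩ := (hpos.prefixes (pair_pos hδ) (pair_injective hδ'.ne) hu).2 (2 * k + 1)
    exact ⟨k, f, y, N, le_rfl, hf, hs, hy.trans hN⟩

end Fixed

/-! ### The roots of `x² - m x + n` -/

section Return

/-- The words `W` and `V` of the positive base when the digits of `1` are `M, ν, ν, ν, ⋯`. -/
def periodicWords (M ν : ℕ) : ℕ → List (Fin 2) × List (Fin 2)
  | 0 => ([0], [1])
  | k + 1 => (lpow (periodicWords M ν k).1 M ++ (periodicWords M ν k).2,
      lpow (periodicWords M ν k).1 ν ++ (periodicWords M ν k).2)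

/-- The words and the position of the level `2 j + 1` of the negative base when `l + δ` is sent
to `l`. -/
noncomputable def returnLevel (β δ : ℝ) (M ν : ℕ) : ℕ → List (Fin 2) × List (Fin 2) × ℝ
  | 0 => (lpow [0] M ++ [1], lpow [0] ν ++ [1], 0)
  | j + 1 =>
    let L := returnLevel β δ M ν j
    let a := L.2.1 ++ lpow L.1 M
    let c := L.2.1 ++ lpow L.1 ν
    (lpow a M ++ c, lpow a ν ++ c, L.2.2 + (1 - δ) * β ^ (2 * j + 1) - M * β ^ (2 * j + 1))

variable {β δ : ℝ} {M n ν : ℕ}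

theorem returnLevel_isImage (hM : 1 ≤ M) (hν : 1 ≤ ν) (j : ℕ) :
    IsImage morTilde (returnLevel β δ M ν j).1 ∧
      IsImage morTilde (returnLevel β δ M ν j).2.1 := by
  have hbase : ∀ N, 1 ≤ N → IsImage morTilde (lpow [0] N ++ [1]) := by
    intro N hN
    obtain ⟨N, rfl⟩ := Nat.exists_eq_add_of_le' hN
    rw [lpow_succ', List.append_assoc]
    exact (IsImage.lpow ⟨[0], rfl⟩ N).append ⟨[1], rfl⟩
  induction j with
  | zero => exact ⟨hbase M hM, hbase ν hν⟩
  | succ j ih =>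
    obtain ⟨ha, hc⟩ := ih
    have ha1 := hc.append (ha.lpow M)
    have hc1 := hc.append (ha.lpow ν)
    exact ⟨(ha1.lpow M).append hc1, (ha1.lpow ν).append hc1⟩

/-- The words of the negative base are conjugate to those of the positive base. -/
theorem returnLevel_conj (j : ℕ) : ∃ z,
    z ++ (periodicWords M ν (2 * j + 1)).1 = (returnLevel β δ M ν j).1 ++ z ∧
    z ++ (periodicWords M ν (2 * j + 1)).2 = (returnLevel β δ M ν j).2.1 ++ z := by
  induction j with
  | zero => exact ⟨[], by simp [periodicWords, returnLevel], by simp [periodicWords, returnLevel]⟩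
  | succ j ih =>
    obtain ⟨z, hW, hV⟩ := ih
    have h1 := conj_return hW hV M
    have h2 := conj_return hW hV ν
    exact ⟨_, conj_append_return h1 h2 M, conj_append_return h1 h2 ν⟩

theorem returnLevel_coding (hβ : 1 < β) (hM : β = M + δ) (hδ : 0 < δ) (hδ' : δ < 1)
    (hnq : M = n + ν) (hν : 1 ≤ ν) (hret : -β * (negLeft β + δ) = negLeft β + n)
    (hβδ : β * δ = ν + δ) (hneg : negLeft β + δ < 0)
    (hk' : ∀ k, negLeft β ∉ zeroSet (-β) (negLeft β) k ∧
      negLeft β + δ ∉ zeroSet (-β) (negLeft β) k) (j : ℕ) :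
    NegCoding β δ (2 * j + 1) (returnLevel β δ M ν j).1 (returnLevel β δ M ν j).2.1
      (returnLevel β δ M ν j).2.2
      ((returnLevel β δ M ν j).2.2 + (1 - δ) * β ^ (2 * j + 1)) := by
  induction j with
  | zero =>
    exact negCoding_return_even hβ hM hδ hδ' hnq hν hret hβδ (hk' 0) (by simp)
      (negCoding_zero hβ hneg)
  | succ j ih =>
    have hodd : Odd (2 * j + 1) := odd_two_mul_add_one j
    exact negCoding_return_even hβ hM hδ hδ' hnq hν hret hβδ (hk' _) hodd.add_one
      (negCoding_return_odd hβ hM hδ hδ' hnq hν hret hβδ (hk' _) hodd ih rfl)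

theorem periodicWords_coding (hβ : 1 < β) (hM : β = M + δ) (hδ : 0 < δ) (hδ' : δ < 1)
    (hνM : ν < M) (hβδ : β * δ = ν + δ) (k : ℕ) :
    PosCoding β δ k (periodicWords M ν k).1 (periodicWords M ν k).2 := by
  induction k with
  | zero => exact posCoding_zero hδ
  | succ k ih => exact ih.succ_of_periodic hβ hM hδ hδ' hνM hβδ

/-- The result for the roots of `x² - (M + 1) x + n`, where `M = n + ν`. -/
theorem main_return (hβ : 1 < β) (hM : β = M + δ) (hδ : 0 < δ) (hδ' : δ < 1) (hn : 1 ≤ n)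
    (hν : 1 ≤ ν) (hnq : M = n + ν) (hβδ : β * δ = ν + δ) :
    (∃ u, CodesRight (betaIntegers β) ![1, δ] u) ∧
    (∃ v, Codes (negBetaIntegers β) ![1, 1 + δ] v) ∧
    ∀ u v, CodesRight (betaIntegers β) ![1, δ] u → Codes (negBetaIntegers β) ![1, 1 + δ] v →
      language u = languageZ (imageZ mor mor_ne_nil v) := by
  have hM' : (M : ℝ) = n + ν := by rw [hnq]; push_cast; ring
  have hn' : (1 : ℝ) ≤ n := by exact_mod_cast hn
  have hM2 : 2 ≤ M := by omega
  have hl := negLeft_eq hβ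
  have hl0 := negLeft_neg hβ
  have hret : -β * (negLeft β + δ) = negLeft β + n := by
    linear_combination hl + hM + hM' - hβδ
  -- Otherwise the left side of `hret` is nonpositive, whereas l + n ≥ n - δ > 0.
  have hneg : negLeft β + δ < 0 := by
    by_contra! h
    nlinarith
  have hk' := notMem_zeroSet_neg hβ hM hδ.le hδ' hneg.ne (Or.inr (by
    have h1 : -β * (negLeft β + δ) - ((n : ℤ) : ℝ) = negLeft β := by
      push_cast; linarith
    rw [T_eq (n : ℤ) (by rw [h1]; constructor <;> linarith), h1]))
  have hc := returnLevel_coding (ν := ν) hβ hM hδ hδ' hnq hν hret hβδ hneg hk'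
  have hrec : ∀ j, ∃ c x, (returnLevel β δ M ν (j + 1)).1 =
      lpow (c ++ lpow (returnLevel β δ M ν j).1 M) M ++ x := fun j => ⟨_, _, rfl⟩
  have hzero : ∀ j, 0 ∈ (returnLevel β δ M ν j).1 := by
    refine zero_mem_of_recursion hM2 ?_ hrec
    change (0 : Fin 2) ∈ lpow [0] M ++ [1]
    obtain ⟨N, rfl⟩ := Nat.exists_eq_add_of_le' hM2
    rw [lpow_succ]
    simp
  have hpos : PosTiling (posIntegers β) ![1, δ] fun k => (periodicWords M ν k).1 :=
    posTiling_of_coding hβ hM2 (periodicWords_coding hβ hM hδ hδ' (by omega) hβδ) fun _ => rfl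
  have hneg : NegTiling (negBetaIntegers β) δ (fun j => (returnLevel β δ M ν j).1)
      fun j => (returnLevel β δ M ν j).2.2 := by
    refine negTiling_of_coding hβ hM hδ hδ' hk' hM2 1 (fun j => (hc j).first) (fun j => ?_)
      fun j => ?_
    · obtain ⟨w, hw⟩ := (returnLevel_isImage (β := β) (δ := δ) (M := M) (by omega) hν j).1
      rw [hw]
      exact not_infix_flatMap_morTilde w
    · obtain ⟨c, x, h⟩ := hrec j
      obtain ⟨X, Y, hXY, hX, hY⟩ := sandwich_step (c := c) hM2 (hzero j) x
      exact ⟨j + 1, X, Y, h.trans hXY, hX, hY⟩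
  refine ⟨(hpos.hasGaps (pair_pos hδ)).exists_codesRight (pair_pos hδ) hpos.zero_mem
    (hpos.nonneg (pair_pos hδ)), hneg.exists_codes hδ, fun u v hu hv => ?_⟩
  rw [languageZ_mor]
  refine language_eq_of_recursion hδ hδ' hM2 hpos hneg (V := fun k => (periodicWords M ν k).2)
    (fun _ => rfl) hrec (fun j => ?_) (fun j => ?_) hu hv
  · obtain ⟨z, h, -⟩ := returnLevel_conj (β := β) (δ := δ) (M := M) (ν := ν) j
    exact (infix_of_conj h.symm).2
  · obtain ⟨z, h, -⟩ := returnLevel_conj (β := β) (δ := δ) (M := M) (ν := ν) j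
    exact (infix_of_conj h.symm).1

end Return

end BetaInt

/-! ### From the quadratic equations to the parameters M and δ. -/

theorem theoremt :
    (∀ (m n : ℕ) (β : ℝ), 1 ≤ n → n < m → 1 < β → β ^ 2 - (m : ℝ) * β - (n : ℝ) = 0 →
      (∃ u : ℕ → Fin 2,
        BetaInt.CodesRight (BetaInt.betaIntegers β) ![1, (n : ℝ) / β] u) ∧
      (∃ v : ℤ → Fin 2,
        BetaInt.Codes (BetaInt.negBetaIntegers β) ![1, 1 + (n : ℝ) / β] v) ∧
      (∀ (u : ℕ → Fin 2) (v : ℤ → Fin 2),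
        BetaInt.CodesRight (BetaInt.betaIntegers β) ![1, (n : ℝ) / β] u →
        BetaInt.Codes (BetaInt.negBetaIntegers β) ![1, 1 + (n : ℝ) / β] v →
        BetaInt.language u =
            BetaInt.languageZ (BetaInt.imageZ BetaInt.morTilde BetaInt.morTilde_ne_nil v) ∧
          (n = 1 →
            u = BetaInt.image BetaInt.mor BetaInt.mor_ne_nil (BetaInt.rightPart v)))) ∧
    (∀ (m n : ℕ) (β : ℝ), 1 ≤ n → n + 2 ≤ m → 1 < β → β ^ 2 - (m : ℝ) * β + (n : ℝ) = 0 →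
      (∃ u : ℕ → Fin 2,
        BetaInt.CodesRight (BetaInt.betaIntegers β) ![1, 1 - (n : ℝ) / β] u) ∧
      (∃ v : ℤ → Fin 2,
        BetaInt.Codes (BetaInt.negBetaIntegers β) ![1, 2 - (n : ℝ) / β] v) ∧
      (∀ (u : ℕ → Fin 2) (v : ℤ → Fin 2),
        BetaInt.CodesRight (BetaInt.betaIntegers β) ![1, 1 - (n : ℝ) / β] u →
        BetaInt.Codes (BetaInt.negBetaIntegers β) ![1, 2 - (n : ℝ) / β] v →
        BetaInt.language u =
          BetaInt.languageZ (BetaInt.imageZ BetaInt.mor BetaInt.mor_ne_nil v))) := by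
  constructor
  · intro m n β hn hnm hβ heq
    obtain ⟨p, rfl⟩ := Nat.exists_eq_add_of_le' hn
    obtain ⟨ρ, hρ, hm⟩ : ∃ ρ, 1 ≤ ρ ∧ m = ρ + 1 + p := ⟨m - (p + 1), by omega, by omega⟩
    have hβ0 : 0 < β := by linarith
    have hδ : 0 < ((p + 1 : ℕ) : ℝ) / β := by positivity
    have hβδ : β * (((p + 1 : ℕ) : ℝ) / β) = p + 1 := by
      rw [mul_div_cancel₀ _ hβ0.ne']; push_cast; ring
    have hM : β = m + ((p + 1 : ℕ) : ℝ) / β := by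
      rw [← sub_eq_iff_eq_add', eq_div_iff hβ0.ne']
      linear_combination heq
    have hδ' : ((p + 1 : ℕ) : ℝ) / β < 1 := by
      rw [div_lt_one hβ0]
      have : ((p + 1 : ℕ) : ℝ) < m := by exact_mod_cast hnm
      linarith
    obtain ⟨h1, h2, h3⟩ := BetaInt.main_fixed hβ hM hδ hδ' hρ hm hβδ
    exact ⟨h1, h2, fun u v hu hv => ⟨(h3 u v hu hv).1, fun hp => (h3 u v hu hv).2 (by omega)⟩⟩
  · intro m n β hn hnm hβ heq
    obtain ⟨ν, hν, hm⟩ : ∃ ν, 1 ≤ ν ∧ m = n + ν + 1 := ⟨m - n - 1, by omega, by omega⟩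
    have hβ0 : 0 < β := by linarith
    have hn' : (0 : ℝ) < n := by exact_mod_cast hn
    have hm' : (m : ℝ) = ((n + ν : ℕ) : ℝ) + 1 := by rw [hm]; push_cast; ring
    -- If β ≤ n, then (β - 1)(n - β) ≥ 0; by the equation this product is β(n + 1 - m), which is
    -- negative.
    have hnβ : (n : ℝ) < β := by
      by_contra! h
      have h2 : (n : ℝ) + 2 ≤ m := by exact_mod_cast hnm
      nlinarith [mul_nonneg (sub_nonneg.mpr hβ.le) (sub_nonneg.mpr h)]
    have hδ : 0 < 1 - (n : ℝ) / β := sub_pos.mpr ((div_lt_one hβ0).mpr hnβ)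
    have hδ' : 1 - (n : ℝ) / β < 1 := by
      have : 0 < (n : ℝ) / β := div_pos hn' hβ0
      linarith
    -- The integral part of β is m - 1 here, because n/β = m - β lies strictly between 0 and 1.
    have hM : β = ((n + ν : ℕ) : ℝ) + (1 - (n : ℝ) / β) := by
      have h1 : (n : ℝ) / β = m - β := by
        rw [div_eq_iff hβ0.ne']
        linear_combination heq
      rw [h1, hm']
      ring
    have hβδ : β * (1 - (n : ℝ) / β) = ν + (1 - (n : ℝ) / β) := by
      rw [mul_sub, mul_div_cancel₀ _ hβ0.ne', mul_one]
      push_cast at hM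
      linarith
    have h12 : 2 - (n : ℝ) / β = 1 + (1 - (n : ℝ) / β) := by ring
    rw [h12]
    exact BetaInt.main_return hβ hM hδ hδ' hn hν rfl hβδ
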